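/- Let $x\in\mathbb{R}^n$, let $a_1,\dots,a_m\in\mathbb{R}^n$ be independent standard Gaussian vectors $\mathcal N(0,I_n)$, and let $y_i=(a_i^\top x)^2+\eta_i$, $1\le i\le m$, where the errors $\eta_i$ are arbitrary (they may depend on the $a_i$). For a threshold $\alpha_y$ put $\lambda_0=\sqrt{\frac1m\sum_{l=1}^m y_l}$ and \[ Y=\frac1m\sum_{i=1}^m y_i\,a_ia_i^\top\,\mathbf 1_{\{|y_i|\le\alpha_y^2\,\frac1m\sum_{l=1}^m y_l\}} , \] let $\tilde z$ be any unit-norm eigenvector of $Y$ for its largest eigenvalue, and let the truncated spectral estimate be \[ z^{(0)}=\sqrt{\tfrac{mn}{\sum_{i=1}^m\|a_i\|^2}}\;\lambda_0\tilde z ,\qquad\text{or, in its simplified version for Gaussian designs,}\qquad z^{(0)}=\lambda_0\tilde z . \] Write $\mathrm{dist}(z,x)=\min\{\|z-x\|,\|z+x\|\}$, and for $\varepsilon>0$ consider the condition \[ (\ast)\qquad |\eta_i|\le\varepsilon\max\{\|x\|^2,(a_i^\top x)^2\},\qquad 1\le i\le m . \] (a) For every $\delta>0$ and every $\alpha_y\ge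 3$ there are constants $\varepsilon,c_0,c>0$, depending only on $\delta$ and $\alpha_y$, such that for all $n,m$ with $m>c_0n$, all $x\in\mathbb{R}^n$ and all $\eta$, the following holds with probability exceeding $1-e^{-cm}$: if $(\ast)$ is satisfied, then every truncated spectral estimate obeys $\mathrm{dist}(z^{(0)},x)\le\delta\|x\|$. In particular, if $(\ast)$ always holds, then $\mathrm{dist}(z^{(0)},x)\le\delta\|x\|$ with probability exceeding $1-e^{-cm}$. (b) The Poisson model satisfies $(\ast)$ with high probability when $\|x\|\gtrsim\log m$: for every $C>0$ there is a constant $c>0$, depending only on $C$, such that, whenever $0<\varepsilon\le1$, $\|x\|\ge C\log m$ and, conditionally on $a_1,\dots,a_m$, the $y_i$ are independent with $y_i\sim\mathsf{Poisson}((a_i^\top x)^2)$, the errors $\eta_i=y_i-(a_i^\top x)^2$ satisfy $(\ast)$ with probability at least $1-2m\,e^{-c\varepsilon^2\log^2 m}$, which tends to $1$ as $m\to\infty$ for fixed $\varepsilon$. -/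

import Mathlib

open MeasureTheory ProbabilityTheory
open scoped ENNReal

noncomputable section

/-- The Euclidean space `ℝⁿ`. -/
abbrev Vec (n : ℕ) : Type := EuclideanSpace ℝ (Fin n)

/-- Euclidean distance modulo the global sign: `min ‖z ± x‖`. -/
def signDist {n : ℕ} (z x : Vec n) : ℝ := min ‖z - x‖ ‖z + x‖

/-- The empirical mean `(1/m) ∑ yₗ`. -/
def empMean {m : ℕ} (y : Fin m → ℝ) : ℝ := (1 / (m : ℝ)) * ∑ l, y l

/-- `λ₀ = √((1/m) ∑ yₗ)`. -/
def lambdaZero {m : ℕ} (y : Fin m → ℝ) : ℝ := Real.sqrt (empMean y)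

open Classical in
/-- The truncated sum `Y = (1/m) ∑ yᵢ aᵢ aᵢᵀ 1{|yᵢ| ≤ α² (1/m) ∑ yₗ}`, as an operator on `ℝⁿ`
(`rankOne ℝ u u` is `w ↦ ⟪u, w⟫ u`, that is, `u uᵀ`). -/
def truncatedY {n m : ℕ} (α : ℝ) (a : Fin m → Vec n) (y : Fin m → ℝ) : Vec n →L[ℝ] Vec n :=
  (1 / (m : ℝ)) • ∑ i, (if |y i| ≤ α ^ 2 * empMean y then y i else 0) •
    InnerProductSpace.rankOne ℝ (a i) (a i)

/-- `v` is a unit-norm eigenvector of `T` for the largest eigenvalue of `T`. Such a `v` is never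
unique (`-v` is another one), so statements quantify over all of them. -/
def IsLeadingEigenvector {n : ℕ} (T : Vec n →L[ℝ] Vec n) (v : Vec n) : Prop :=
  ‖v‖ = 1 ∧ ∃ μ : ℝ, Module.End.HasEigenvector (T : Vec n →ₗ[ℝ] Vec n) μ v ∧
    ∀ ν : ℝ, Module.End.HasEigenvalue (T : Vec n →ₗ[ℝ] Vec n) ν → ν ≤ μ

/-- The factor `√(mn / ∑ ‖aᵢ‖²)`. -/
def designScale {n m : ℕ} (a : Fin m → Vec n) : ℝ :=
  Real.sqrt (((m : ℝ) * (n : ℝ)) / ∑ i, ‖a i‖ ^ 2)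

/-- `z` is an output of the truncated spectral method: with `v` a leading eigenvector of `Y`,
it is `√(mn / ∑ ‖aᵢ‖²) λ₀ v`, or its simplified version `λ₀ v` for standard Gaussian designs. -/
def IsTruncatedSpectralEstimate {n m : ℕ} (α : ℝ) (a : Fin m → Vec n) (y : Fin m → ℝ)
    (z : Vec n) : Prop :=
  ∃ v : Vec n, IsLeadingEigenvector (truncatedY α a y) v ∧
    (z = (designScale a * lambdaZero y) • v ∨ z = lambdaZero y • v)

/-- The intensity `(aᵢᵀ x)²`. -/
def intensity {n m : ℕ} (a : Fin m → Vec n) (x : Vec n) (i : Fin m) : ℝ :=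
  (inner ℝ (a i) x) ^ 2

/-- The error bound `|ηᵢ| ≤ ε max {‖x‖², (aᵢᵀ x)²}` for all `i`. -/
def NoiseBound {n m : ℕ} (ε : ℝ) (a : Fin m → Vec n) (x : Vec n) (η : Fin m → ℝ) : Prop :=
  ∀ i, |η i| ≤ ε * max (‖x‖ ^ 2) (intensity a x i)

/-- The design vectors are independent and standard Gaussian. -/
def IsGaussianDesign {n m : ℕ} {Ω : Type*} [MeasurableSpace Ω] (P : Measure Ω)
    (a : Fin m → Ω → Vec n) : Prop :=
  (∀ i, HasLaw (a i) (stdGaussian (Vec n)) P) ∧ iIndepFun a P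

/-- Poisson data model: conditionally on the design vectors, the counts `N i` are independent and
Poisson distributed with mean `(aᵢᵀ x)²`. -/
def IsPoissonData {n m : ℕ} {Ω : Type*} [MeasurableSpace Ω] (P : Measure Ω)
    [IsProbabilityMeasure P] (a : Fin m → Ω → Vec n) (x : Vec n) (N : Fin m → Ω → ℕ) : Prop :=
  (∀ i, AEMeasurable (N i) P) ∧
    ∀ᵐ b ∂(P.map (fun ω i => a i ω)),
      condDistrib (fun ω i => N i ω) (fun ω i => a i ω) P b =
        Measure.pi (fun i => poissonMeasure (Real.toNNReal (intensity b x i)))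

end

/-! Accuracy. For `x = r • e` with `‖e‖ = 1` and `r > 0`, put `gᵢ = ⟪aᵢ, e⟫`; dividing by `r²` turns
the data into `gᵢ²` plus noise of size at most `τ max(1, gᵢ²)`. Without noise and with the ideal
threshold `α²`, the matrix would be the covariance of the `aᵢ` weighted by `truncSq α gᵢ`. Its mean
is `b` on the complement of `e` and `b'` along `e`, and `b' - b ≥ 1/2` as soon as `α ≥ 3`
(`half_le_integral_truncSq`).

The noise may depend on the design, so it is never averaged. Its effect on each truncated weight is
bounded by `noiseWeight α τ gᵢ`, a function of the design alone (`abs_truncated_sub_truncSq_le`):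
noise and threshold error matter much only when `gᵢ²` lies in a thin band around `α²`, which has
small Gaussian probability (`exists_noiseWeight_small`). Hence one event, not involving the noise,
handles every admissible noise: the covariances with weights `1`, `truncSq` and `noiseWeight` are
uniformly close to their means. This event is likely by a Chernoff bound for variables dominated by
a squared Gaussian, together with a net of at most `5 ^ n` points
(`measure_weightedForm_deviation_le`).

On that event, comparing the quadratic form at the leading eigenvector with its value at `e` forces
alignment through the gap, and the weight-`1` covariance controls `λ₀` and the design scale
(`signDist_le_of_good_design`).

Poisson data. Conditionally on the design, a Chernoff bound at `±ε/2` and a union bound over the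
counts suffice. -/

/-! ### Gaussian moments and weighted second moments -/

theorem hasLaw_inner_stdGaussian {n : ℕ} {u : Vec n} (hu : ‖u‖ = 1) :
    HasLaw (fun a : Vec n => inner ℝ a u) (gaussianReal 0 1) (stdGaussian (Vec n)) := by
  refine ⟨by fun_prop, ?_⟩
  have h := IsGaussian.map_eq_gaussianReal (μ := stdGaussian (Vec n)) (innerSL ℝ u)
  rw [integral_strongDual_stdGaussian, variance_dual_stdGaussian, innerSL_apply_norm, hu] at h
  simp only [one_pow, Real.toNNReal_one] at h
  rw [← h]
  congr 1
  ext a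
  simp [real_inner_comm]

theorem integrable_exp_sq_gaussianReal :
    Integrable (fun t : ℝ => Real.exp (t ^ 2 / 4)) (gaussianReal 0 1) := by
  rw [gaussianReal_of_var_ne_zero _ one_ne_zero, integrable_withDensity_iff
    (measurable_gaussianPDF _ _) (ae_of_all _ fun _ => gaussianPDF_lt_top)]
  have h : Integrable (fun t : ℝ => (√(2 * Real.pi))⁻¹ * Real.exp (-(1 / 4) * t ^ 2)) :=
    (integrable_exp_neg_mul_sq (by norm_num)).const_mul _
  refine h.congr (ae_of_all _ fun t => ?_)
  simp only [toReal_gaussianPDF, gaussianPDFReal, NNReal.coe_one, mul_one, sub_zero]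
  rw [mul_comm (Real.exp (t ^ 2 / 4)), mul_assoc, ← Real.exp_add]
  ring_nf

theorem deriv_polynomial_mul_exp (p : Polynomial ℝ) :
    deriv (fun t : ℝ => p.eval t * Real.exp (t ^ 2 / 2)) =
      fun t => (Polynomial.derivative p + Polynomial.X * p).eval t * Real.exp (t ^ 2 / 2) := by
  ext t
  have h1 : HasDerivAt (fun t : ℝ => t ^ 2 / 2) t t := by
    have := (hasDerivAt_pow 2 t).div_const 2
    simpa using this
  have := (p.hasDerivAt t).mul h1.exp
  refine this.deriv.trans ?_
  simp
  ring

theorem iteratedDeriv_exp_sq_half (k : ℕ) :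
    iteratedDeriv k (fun t : ℝ => Real.exp (t ^ 2 / 2)) = fun t =>
      ((fun p : Polynomial ℝ => Polynomial.derivative p + Polynomial.X * p)^[k] 1).eval t *
        Real.exp (t ^ 2 / 2) := by
  induction k with
  | zero => simp
  | succ k ih =>
    rw [iteratedDeriv_succ, ih, deriv_polynomial_mul_exp, Function.iterate_succ_apply']

/-- Moments are derivatives at `0` of the moment generating function `exp (t²/2)`. Each derivative
is a polynomial times `exp (t²/2)`, and differentiating sends the polynomial `p` to `p' + X p`, so
the low moments become a finite computation. -/
theorem integral_pow_gaussianReal (k : ℕ) :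
    ∫ t : ℝ, t ^ k ∂gaussianReal 0 1 =
      ((fun p : Polynomial ℝ => Polynomial.derivative p + Polynomial.X * p)^[k] 1).eval 0 := by
  have h := iteratedDeriv_mgf_zero (X := id) (μ := gaussianReal 0 1) (by simp) k
  rw [mgf_id_gaussianReal] at h
  simp only [zero_mul, NNReal.coe_one, one_mul, zero_add, iteratedDeriv_exp_sq_half] at h
  simpa using h.symm

theorem integral_sq_gaussianReal : ∫ t : ℝ, t ^ 2 ∂gaussianReal 0 1 = 1 := by
  rw [integral_pow_gaussianReal]; simp [Function.iterate_succ_apply']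

theorem integral_pow_four_gaussianReal : ∫ t : ℝ, t ^ 4 ∂gaussianReal 0 1 = 3 := by
  rw [integral_pow_gaussianReal]; simp [Function.iterate_succ_apply']; norm_num

theorem integral_pow_six_gaussianReal : ∫ t : ℝ, t ^ 6 ∂gaussianReal 0 1 = 15 := by
  rw [integral_pow_gaussianReal]; simp [Function.iterate_succ_apply']; norm_num

theorem integrable_pow_gaussianReal (k : ℕ) :
    Integrable (fun t : ℝ => t ^ k) (gaussianReal 0 1) := by
  have := (memLp_id_gaussianReal (μ := 0) (v := 1) k).integrable_norm_pow'
  refine (integrable_norm_iff (by fun_prop)).1 (this.congr (ae_of_all _ fun t => ?_))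
  simp

theorem integrable_bounded_mul_pow {f : ℝ → ℝ} (hf : Measurable f) {B : ℝ} (hB : ∀ t, |f t| ≤ B)
    (k : ℕ) : Integrable (fun t : ℝ => f t * t ^ k) (gaussianReal 0 1) :=
  (integrable_pow_gaussianReal k).bdd_mul hf.aestronglyMeasurable (ae_of_all _ hB)

theorem integral_inner_stdGaussian {n : ℕ} (u : Vec n) :
    ∫ a, inner ℝ a u ∂stdGaussian (Vec n) = 0 := by
  have := integral_strongDual_stdGaussian (E := Vec n) (innerSL ℝ u)
  simpa [real_inner_comm] using this

theorem integral_inner_mul_inner_stdGaussian {n : ℕ} (u w : Vec n) :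
    ∫ a, inner ℝ a u * inner ℝ a w ∂stdGaussian (Vec n) = inner ℝ u w := by
  have hc := covarianceBilin_apply (μ := stdGaussian (Vec n)) IsGaussian.memLp_two_id u w
  rw [covarianceBilin_stdGaussian] at hc
  have h1 : (innerSL ℝ u) w = (inner ℝ u w : ℝ) := rfl
  rw [h1] at hc
  rw [hc]
  simp [real_inner_comm]

theorem integrable_inner_mul_inner_stdGaussian {n : ℕ} (u w : Vec n) :
    Integrable (fun a => inner ℝ a u * inner ℝ a w) (stdGaussian (Vec n)) := by
  have h : ∀ v : Vec n, MemLp (fun a : Vec n => (inner ℝ a v : ℝ)) 2 (stdGaussian (Vec n)) :=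
    fun v => (IsGaussian.memLp_two_id (μ := stdGaussian (Vec n))).inner_const v
  exact (h u).integrable_mul (h w)

theorem indepFun_inner_stdGaussian {n : ℕ} {e w : Vec n} (h : inner ℝ e w = 0) :
    IndepFun (fun a : Vec n => inner ℝ a e) (fun a : Vec n => inner ℝ a w)
      (stdGaussian (Vec n)) := by
  refine HasGaussianLaw.indepFun_of_covariance_eq_zero ?_ ?_
  · refine ⟨?_⟩
    have : (fun a : Vec n => ((inner ℝ a e : ℝ), (inner ℝ a w : ℝ))) =
        ((innerSL ℝ e).prod (innerSL ℝ w) : Vec n →L[ℝ] ℝ × ℝ) := by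
      ext a <;> simp [real_inner_comm]
    rw [this]
    infer_instance
  · rw [covariance]
    simp only [integral_inner_stdGaussian, sub_zero]
    rw [integral_inner_mul_inner_stdGaussian, h]

/-- Split `u = c e + w` with `w ⟂ e`. The projections of a Gaussian vector on `e` and `w` are
uncorrelated, hence independent, so the cross term vanishes and the `w` term factors. -/
theorem integral_mul_inner_sq {n : ℕ} {e : Vec n} (he : ‖e‖ = 1) {f : ℝ → ℝ} (hf : Measurable f)
    {B : ℝ} (hB : ∀ t, |f t| ≤ B) (u : Vec n) :
    ∫ a, f (inner ℝ a e) * (inner ℝ a u) ^ 2 ∂stdGaussian (Vec n) =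
      (∫ t, f t ∂gaussianReal 0 1) * (‖u‖ ^ 2 - (inner ℝ u e) ^ 2) +
        (∫ t, f t * t ^ 2 ∂gaussianReal 0 1) * (inner ℝ u e) ^ 2 := by
  set c : ℝ := inner ℝ u e with hc
  set w : Vec n := u - c • e with hw
  have hee : (inner ℝ e e : ℝ) = 1 := by rw [real_inner_self_eq_norm_sq, he, one_pow]
  have hew : (inner ℝ e w : ℝ) = 0 := by
    rw [hw, inner_sub_right, real_inner_smul_right, hee, real_inner_comm]; ring
  have hww : (inner ℝ w w : ℝ) = ‖u‖ ^ 2 - c ^ 2 := by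
    rw [hw, inner_sub_left, inner_sub_right, inner_sub_right, real_inner_smul_left,
      real_inner_smul_right, real_inner_smul_right, real_inner_smul_left, hee,
      real_inner_self_eq_norm_sq, real_inner_comm u e, ← hc]
    ring
  have hind := indepFun_inner_stdGaussian hew
  have hlaw := hasLaw_inner_stdGaussian he
  have hbd : ∀ p q : Vec n, Integrable (fun a => f (inner ℝ a e) * (inner ℝ a p * inner ℝ a q))
      (stdGaussian (Vec n)) := fun p q =>
    (integrable_inner_mul_inner_stdGaussian p q).bdd_mul
      (hf.comp (by fun_prop)).aestronglyMeasurable (ae_of_all _ fun a => hB _)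
  have hsplit : ∀ a : Vec n, f (inner ℝ a e) * (inner ℝ a u) ^ 2 =
      c ^ 2 * (f (inner ℝ a e) * (inner ℝ a e * inner ℝ a e)) +
        2 * c * (f (inner ℝ a e) * (inner ℝ a e * inner ℝ a w)) +
        f (inner ℝ a e) * (inner ℝ a w * inner ℝ a w) := fun a => by
    have : (inner ℝ a u : ℝ) = c * inner ℝ a e + inner ℝ a w := by
      rw [hw, inner_sub_right, real_inner_smul_right]; ring
    rw [this]; ring
  simp_rw [hsplit]
  rw [integral_add (((hbd e e).const_mul _).fun_add ((hbd e w).const_mul _)) (hbd w w),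
    integral_add ((hbd e e).const_mul _) ((hbd e w).const_mul _), integral_const_mul,
    integral_const_mul]
  have h1 : ∫ a, f (inner ℝ a e) * (inner ℝ a e * inner ℝ a e) ∂stdGaussian (Vec n) =
      ∫ t, f t * t ^ 2 ∂gaussianReal 0 1 := by
    rw [← hlaw.integral_comp (f := fun t => f t * t ^ 2) (by fun_prop)]
    simp [sq]
  have h2 : ∫ a, f (inner ℝ a e) * (inner ℝ a e * inner ℝ a w) ∂stdGaussian (Vec n) = 0 := by
    have := hind.integral_fun_comp_mul_comp (f := fun t => f t * t) (g := fun t => t)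
      (by fun_prop) (by fun_prop) (by fun_prop) (by fun_prop)
    simp only [integral_inner_stdGaussian, mul_zero] at this
    simpa [mul_assoc] using this
  have h3 : ∫ a, f (inner ℝ a e) * (inner ℝ a w * inner ℝ a w) ∂stdGaussian (Vec n) =
      (∫ t, f t ∂gaussianReal 0 1) * (‖u‖ ^ 2 - c ^ 2) := by
    have := hind.integral_fun_comp_mul_comp (f := f) (g := fun t => t * t)
      (by fun_prop) (by fun_prop) (by fun_prop) (by fun_prop)
    rw [this, integral_inner_mul_inner_stdGaussian, hww,
      ← hlaw.integral_comp (f := f) (by fun_prop)]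
    rfl
  rw [h1, h2, h3]
  ring

/-! ### Chernoff bounds for variables dominated by a squared Gaussian -/

theorem exp_le_one_add_add_sq_mul_exp_abs (x : ℝ) :
    Real.exp x ≤ 1 + x + x ^ 2 * Real.exp |x| := by
  have h := Complex.norm_exp_sub_sum_le_norm_mul_exp (x : ℂ) 2
  simp only [Finset.sum_range_succ, Finset.sum_range_zero, pow_zero, Nat.factorial, pow_one,
    Nat.cast_one, div_one, zero_add, mul_one, Complex.norm_real, Real.norm_eq_abs, sq_abs] at h
  have h2 : Complex.exp (x : ℂ) - (1 + (x : ℂ)) = ((Real.exp x - (1 + x) : ℝ) : ℂ) := by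
    push_cast; ring
  rw [h2, Complex.norm_real, Real.norm_eq_abs] at h
  linarith [le_abs_self (Real.exp x - (1 + x))]

/-- For `|s| ≤ 1/(8B)` one has `|sZ| ≤ V²/8`, so the remainder in `e^x ≤ 1 + x + x² e^|x|` is at
most `s² B² V⁴ e^(V²/8)`. Since `(V²/8)²/2 ≤ e^(V²/8)`, this is at most `128 B² s² e^(V²/4)`, which
is integrable. -/
theorem mgf_le_of_abs_le_sq {Ω : Type*} [MeasurableSpace Ω] {μ : Measure Ω}
    [IsProbabilityMeasure μ] {V Z : Ω → ℝ} (hV : HasLaw V (gaussianReal 0 1) μ)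
    (hZ : AEMeasurable Z μ) {B : ℝ} (hB : 0 < B) (hZB : ∀ ω, |Z ω| ≤ B * V ω ^ 2)
    {s : ℝ} (hs : |s| ≤ 1 / (8 * B)) :
    Integrable (fun ω => Real.exp (s * Z ω)) μ ∧
      mgf Z μ s ≤ Real.exp (s * μ[Z] +
        128 * (∫ t, Real.exp (t ^ 2 / 4) ∂gaussianReal 0 1) * B ^ 2 * s ^ 2) := by
  have hVm := hV.aemeasurable
  have hG : Integrable (fun ω => Real.exp (V ω ^ 2 / 4)) μ := by
    have := integrable_exp_sq_gaussianReal
    rw [← hV.map_eq] at this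
    exact this.comp_aemeasurable hVm
  have hGi : ∫ ω, Real.exp (V ω ^ 2 / 4) ∂μ = ∫ t, Real.exp (t ^ 2 / 4) ∂gaussianReal 0 1 :=
    hV.integral_comp (f := fun t => Real.exp (t ^ 2 / 4)) (by fun_prop)
  have hsZ : ∀ ω, |s * Z ω| ≤ V ω ^ 2 / 8 := fun ω => by
    rw [abs_mul]
    calc |s| * |Z ω| ≤ 1 / (8 * B) * (B * V ω ^ 2) := by gcongr; exact hZB ω
      _ = V ω ^ 2 / 8 := by field_simp
  have hexp8 : ∀ ω, V ω ^ 4 * Real.exp (V ω ^ 2 / 8) ≤ 128 * Real.exp (V ω ^ 2 / 4) := fun ω => by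
    have h1 := Real.quadratic_le_exp_of_nonneg (x := V ω ^ 2 / 8) (by positivity)
    have h2 : Real.exp (V ω ^ 2 / 4) = Real.exp (V ω ^ 2 / 8) * Real.exp (V ω ^ 2 / 8) := by
      rw [← Real.exp_add]; ring_nf
    rw [h2]
    have h3 : V ω ^ 4 ≤ 128 * Real.exp (V ω ^ 2 / 8) := by
      nlinarith [sq_nonneg (V ω)]
    nlinarith [Real.exp_pos (V ω ^ 2 / 8)]
  have hpt : ∀ ω, Real.exp (s * Z ω) ≤
      1 + s * Z ω + 128 * B ^ 2 * s ^ 2 * Real.exp (V ω ^ 2 / 4) := fun ω => by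
    refine (exp_le_one_add_add_sq_mul_exp_abs _).trans ?_
    have h1 : (s * Z ω) ^ 2 ≤ s ^ 2 * B ^ 2 * V ω ^ 4 := by
      have := pow_le_pow_left₀ (abs_nonneg _) (hZB ω) 2
      rw [sq_abs] at this
      nlinarith [sq_nonneg s]
    have h2 : Real.exp |s * Z ω| ≤ Real.exp (V ω ^ 2 / 8) := Real.exp_le_exp.2 (hsZ ω)
    have h3 : (s * Z ω) ^ 2 * Real.exp |s * Z ω| ≤
        s ^ 2 * B ^ 2 * V ω ^ 4 * Real.exp (V ω ^ 2 / 8) := by gcongr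
    have h4 : s ^ 2 * B ^ 2 * (V ω ^ 4 * Real.exp (V ω ^ 2 / 8)) ≤
        s ^ 2 * B ^ 2 * (128 * Real.exp (V ω ^ 2 / 4)) :=
      mul_le_mul_of_nonneg_left (hexp8 ω) (by positivity)
    linarith
  have hint : Integrable (fun ω => Real.exp (s * Z ω)) μ := by
    refine hG.mono' (by fun_prop) (ae_of_all _ fun ω => ?_)
    rw [Real.norm_eq_abs, Real.abs_exp]
    refine Real.exp_le_exp.2 ?_
    have := le_abs_self (s * Z ω)
    nlinarith [hsZ ω, sq_nonneg (V ω)]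
  have hsq : Integrable (fun ω => V ω ^ 2) μ := by
    have := integrable_pow_gaussianReal 2
    rw [← hV.map_eq] at this
    exact this.comp_aemeasurable hVm
  have hZi : Integrable Z μ :=
    (hsq.const_mul B).mono' hZ.aestronglyMeasurable (ae_of_all _ hZB)
  refine ⟨hint, ?_⟩
  calc mgf Z μ s ≤ ∫ ω, (1 + s * Z ω + 128 * B ^ 2 * s ^ 2 * Real.exp (V ω ^ 2 / 4)) ∂μ :=
        integral_mono hint (((integrable_const _).fun_add (hZi.const_mul s)).fun_add (hG.const_mul _)) hpt
    _ = (s * μ[Z] + 128 * (∫ t, Real.exp (t ^ 2 / 4) ∂gaussianReal 0 1) * B ^ 2 * s ^ 2) + 1 := by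
        rw [integral_add ((integrable_const _).fun_add (hZi.const_mul s)) (hG.const_mul _),
          integral_add (integrable_const _) (hZi.const_mul s), integral_const_mul,
          integral_const_mul, hGi]
        simp
        ring
    _ ≤ _ := Real.add_one_le_exp _

/-- The sub-exponential deviation rate at level `τ` for variables dominated by `B g²`, with `g` a
standard Gaussian variable. -/
noncomputable def deviationRate (B τ : ℝ) : ℝ :=
  min (1 / (8 * B)) (τ / (2 * (128 * ((∫ t, Real.exp (t ^ 2 / 4) ∂gaussianReal 0 1) + 1) * B ^ 2)))
    * τ / 2

theorem integral_exp_sq_nonneg : 0 ≤ ∫ t, Real.exp (t ^ 2 / 4) ∂gaussianReal 0 1 :=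
  integral_nonneg fun _ => (Real.exp_pos _).le

theorem deviationRate_pos {B τ : ℝ} (hB : 0 < B) (hτ : 0 < τ) : 0 < deviationRate B τ := by
  have := integral_exp_sq_nonneg
  unfold deviationRate
  positivity

theorem measure_add_le_sum_le {n m : ℕ} {Ω : Type*} [MeasurableSpace Ω] {P : Measure Ω}
    [IsProbabilityMeasure P] {a : Fin m → Ω → Vec n} (ha : IsGaussianDesign P a)
    {B τ : ℝ} (hB : 0 < B) (hτ : 0 < τ) {u : Vec n} (hu : ‖u‖ = 1) {F : Vec n → ℝ}
    (hF : Measurable F) (hFB : ∀ b, |F b| ≤ B * (inner ℝ b u) ^ 2) :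
    P.real {ω | m * (∫ b, F b ∂stdGaussian (Vec n) + τ) ≤ ∑ i, F (a i ω)} ≤
      Real.exp (-(deviationRate B τ * m)) := by
  obtain ⟨hlaw, hind⟩ := ha
  have hK := integral_exp_sq_nonneg
  set K := ∫ t, Real.exp (t ^ 2 / 4) ∂gaussianReal 0 1 with hKdef
  set D := 128 * (K + 1) * B ^ 2 with hD
  have hDpos : 0 < D := by positivity
  -- The first bound keeps `s` in the range of the mgf estimate; the second makes the quadratic term
  -- cost at most half of the linear gain `sτ`. Using `K + 1` in `D` gives positivity from `0 ≤ K`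
  -- alone.
  set s := min (1 / (8 * B)) (τ / (2 * D)) with hs
  have hspos : 0 < s := by positivity
  have hrate : deviationRate B τ = s * τ / 2 := rfl
  have hsabs : |s| ≤ 1 / (8 * B) := by rw [abs_of_pos hspos]; exact min_le_left _ _
  have hsD : D * s ^ 2 ≤ s * τ / 2 := by
    have h1 : s * (2 * D) ≤ τ := (le_div_iff₀ (by positivity)).1 (min_le_right _ _)
    nlinarith
  set E := ∫ b, F b ∂stdGaussian (Vec n) with hE
  have hX : ∀ i, AEMeasurable (fun ω => F (a i ω)) P := fun i =>
    hF.comp_aemeasurable (hlaw i).aemeasurable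
  have hEi : ∀ i, ∫ ω, F (a i ω) ∂P = E := fun i =>
    (hlaw i).integral_comp (f := F) hF.aestronglyMeasurable
  have hmgf := fun i => mgf_le_of_abs_le_sq (μ := P) ((hasLaw_inner_stdGaussian hu).comp (hlaw i))
    (hX i) hB (fun ω => hFB (a i ω)) hsabs
  have hindF : iIndepFun (fun i ω => F (a i ω)) P := hind.comp (fun _ => F) fun _ => hF
  -- If this failed, the mgf of the sum would take its default value `0`, whereas by independence it
  -- is a product of positive factors.
  have hint : Integrable (fun ω => Real.exp (s * (∑ i, fun ω => F (a i ω)) ω)) P :=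
    of_not_not fun h => (Finset.prod_pos fun i _ => mgf_pos (hmgf i).1).ne'
      ((hindF.mgf_sum₀ hX Finset.univ).symm.trans (mgf_undef h))
  have hch := measure_ge_le_exp_mul_mgf (μ := P) (X := ∑ i, fun ω => F (a i ω))
    (m * (E + τ)) hspos.le hint
  simp only [Finset.sum_apply] at hch
  refine hch.trans ?_
  rw [hindF.mgf_sum₀ hX]
  calc Real.exp (-s * (m * (E + τ))) * ∏ i, mgf (fun ω => F (a i ω)) P s
      ≤ Real.exp (-s * (m * (E + τ))) * ∏ _i : Fin m, Real.exp (s * E + s * τ / 2) := by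
        gcongr with i
        · exact fun i _ => mgf_nonneg
        · refine (hmgf i).2.trans (Real.exp_le_exp.2 ?_)
          rw [hEi]
          nlinarith [sq_nonneg (B * s)]
    _ = Real.exp (-(deviationRate B τ * m)) := by
        rw [Finset.prod_const, ← Real.exp_nat_mul, ← Real.exp_add, hrate]
        simp
        ring

theorem measure_abs_sub_le {n m : ℕ} {Ω : Type*} [MeasurableSpace Ω] {P : Measure Ω}
    [IsProbabilityMeasure P] {a : Fin m → Ω → Vec n} (ha : IsGaussianDesign P a)
    {B τ : ℝ} (hB : 0 < B) (hτ : 0 < τ) {u : Vec n} (hu : ‖u‖ = 1) {F : Vec n → ℝ}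
    (hF : Measurable F) (hFB : ∀ b, |F b| ≤ B * (inner ℝ b u) ^ 2) (hm : 0 < m) :
    P.real {ω | τ < |1 / (m : ℝ) * ∑ i, F (a i ω) - ∫ b, F b ∂stdGaussian (Vec n)|} ≤
      2 * Real.exp (-(deviationRate B τ * m)) := by
  have h1 := measure_add_le_sum_le ha hB hτ hu hF hFB
  have h2 := measure_add_le_sum_le ha hB hτ hu hF.neg (fun b => by simpa using hFB b)
  have hm' : (0 : ℝ) < m := by exact_mod_cast hm
  have hsub : {ω | τ < |1 / (m : ℝ) * ∑ i, F (a i ω) - ∫ b, F b ∂stdGaussian (Vec n)|} ⊆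
      {ω | m * (∫ b, F b ∂stdGaussian (Vec n) + τ) ≤ ∑ i, F (a i ω)} ∪
      {ω | m * (∫ b, (-F) b ∂stdGaussian (Vec n) + τ) ≤ ∑ i, (-F) (a i ω)} := by
    intro ω hω
    simp only [Set.mem_ofPred_eq, Set.mem_union, Pi.neg_apply, integral_neg,
      Finset.sum_neg_distrib] at hω ⊢
    set S := ∑ i, F (a i ω)
    set E := ∫ b, F b ∂stdGaussian (Vec n)
    have hS : S = m * (1 / (m : ℝ) * S) := by field_simp
    rcases lt_abs.1 hω with h | h
    · left; rw [hS]; exact mul_le_mul_of_nonneg_left (by linarith) hm'.le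
    · right
      rw [hS]
      nlinarith
  calc _ ≤ _ := measureReal_mono hsub
    _ ≤ _ := measureReal_union_le _ _
    _ ≤ _ := by rw [two_mul]; exact add_le_add h1 h2

/-! ### Nets on the sphere and quadratic forms -/

/-- Doubling the points gives a `1`-separated set in the ball of radius `2`, to which the
Besicovitch packing bound `5 ^ n` applies. -/
theorem encard_le_of_isSeparated_sphere {n : ℕ} {C : Set (Vec n)}
    (hC : C ⊆ Metric.sphere 0 1) (hsep : Metric.IsSeparated (1 / 2 : NNReal) C) :
    C.encard ≤ ((5 ^ n : ℕ) : ℕ∞) := by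
  classical
  by_contra! hlt
  obtain ⟨t, htC, ht⟩ := Set.exists_subset_encard_eq (Order.add_one_le_of_lt hlt)
  have htfin : t.Finite := Set.finite_of_encard_eq_coe (k := 5 ^ n + 1) (by rw [ht]; norm_cast)
  set s : Finset (Vec n) := htfin.toFinset.image (fun v => (2 : ℝ) • v) with hs
  have hcard : s.card = 5 ^ n + 1 := by
    rw [hs, Finset.card_image_of_injective _ (smul_right_injective _ two_ne_zero)]
    rw [htfin.encard_eq_coe_toFinset_card] at ht
    exact_mod_cast ht
  have := Besicovitch.card_le_of_separated s ?_ ?_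
  · rw [hcard, finrank_euclideanSpace_fin] at this
    omega
  · intro c hc
    obtain ⟨v, hv, rfl⟩ := Finset.mem_image.1 hc
    have := hC (htC (htfin.mem_toFinset.1 hv))
    rw [mem_sphere_zero_iff_norm] at this
    rw [norm_smul, this]; norm_num
  · intro c hc d hd hcd
    obtain ⟨v, hv, rfl⟩ := Finset.mem_image.1 hc
    obtain ⟨w, hw, rfl⟩ := Finset.mem_image.1 hd
    have h := hsep (htC (htfin.mem_toFinset.1 hv)) (htC (htfin.mem_toFinset.1 hw))
      (fun h => hcd (by rw [h]))
    have h : ((1 / 2 : NNReal) : ℝ≥0∞) < edist v w := h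
    rw [edist_nndist] at h
    have h' : (1 / 2 : ℝ) < ‖v - w‖ := by
      rw [← dist_eq_norm, dist_nndist]
      exact_mod_cast (ENNReal.coe_lt_coe.1 h)
    rw [← smul_sub, norm_smul, Real.norm_two]
    linarith

theorem exists_half_net_sphere (n : ℕ) : ∃ N : Finset (Vec n),
    (∀ v ∈ N, ‖v‖ = 1) ∧ N.card ≤ 5 ^ n ∧ ∀ u : Vec n, ‖u‖ = 1 → ∃ v ∈ N, ‖u - v‖ ≤ 1 / 2 := by
  set S : Set (Vec n) := Metric.sphere 0 1
  have hpack : Metric.packingNumber (1 / 2) S ≤ ((5 ^ n : ℕ) : ℕ∞) :=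
    iSup_le fun C => iSup_le fun hC => iSup_le fun hsep => encard_le_of_isSeparated_sphere hC hsep
  have htop : Metric.packingNumber (1 / 2) S ≠ ⊤ := ne_top_of_le_ne_top (by simp) hpack
  set T := Metric.maximalSeparatedSet (1 / 2) S
  have hTcard : T.encard ≤ ((5 ^ n : ℕ) : ℕ∞) := by
    rw [Metric.encard_maximalSeparatedSet htop]; exact hpack
  have hTfin : T.Finite := Set.finite_of_encard_le_coe hTcard
  refine ⟨hTfin.toFinset, fun v hv => ?_, ?_, fun u hu => ?_⟩
  · exact mem_sphere_zero_iff_norm.1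
      (Metric.maximalSeparatedSet_subset (hTfin.mem_toFinset.1 hv))
  · rw [hTfin.encard_eq_coe_toFinset_card] at hTcard
    exact_mod_cast hTcard
  · obtain ⟨v, hv, huv⟩ := Metric.isCover_maximalSeparatedSet htop (mem_sphere_zero_iff_norm.2 hu)
    refine ⟨v, hTfin.mem_toFinset.2 hv, ?_⟩
    have h : edist u v ≤ ((1 / 2 : NNReal) : ℝ≥0∞) := huv
    rw [edist_nndist] at h
    rw [← dist_eq_norm, dist_nndist]
    exact_mod_cast (ENNReal.coe_le_coe.1 h)

/-- Let `R` be the maximum of the form in absolute value on the sphere, attained at `w`, and let `v`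
be a net point near `w`. Symmetry and polarisation bound the change of the form from `v` to `w` by
`31/32 R`, whence `R ≤ τ + 31/32 R`. -/
theorem abs_inner_le_of_half_net {E : Type*} [NormedAddCommGroup E] [InnerProductSpace ℝ E]
    [FiniteDimensional ℝ E] {A : E →L[ℝ] E} (hA : (A : E →ₗ[ℝ] E).IsSymmetric) {N : Set E}
    (hN1 : ∀ v ∈ N, ‖v‖ = 1) (hN : ∀ u : E, ‖u‖ = 1 → ∃ v ∈ N, ‖u - v‖ ≤ 1 / 2) {τ : ℝ}
    (hτ : ∀ v ∈ N, |inner ℝ (A v) v| ≤ τ) (u : E) : |inner ℝ (A u) u| ≤ 32 * τ * ‖u‖ ^ 2 := by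
  have key : ∀ u : E, ‖u‖ = 1 → |inner ℝ (A u) u| ≤ 32 * τ := by
    intro u hu
    have : ProperSpace E := FiniteDimensional.proper_real E
    obtain ⟨w, hw, hmax⟩ := (isCompact_sphere (0 : E) 1).exists_isMaxOn
      ⟨u, mem_sphere_zero_iff_norm.2 hu⟩
      (f := fun u : E => |(inner ℝ (A u) u : ℝ)|) (by fun_prop)
    rw [mem_sphere_zero_iff_norm] at hw
    set R := |(inner ℝ (A w) w : ℝ)| with hR
    have hle : ∀ p : E, |inner ℝ (A p) p| ≤ R * ‖p‖ ^ 2 := by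
      intro p
      rcases eq_or_ne p 0 with rfl | hp
      · simp
      have hp' : 0 < ‖p‖ := norm_pos_iff.2 hp
      have h1 : |inner ℝ (A (‖p‖⁻¹ • p)) (‖p‖⁻¹ • p)| ≤ R :=
        hmax (mem_sphere_zero_iff_norm.2 (by
          rw [norm_smul, norm_inv, norm_norm, inv_mul_cancel₀ hp'.ne']))
      rw [map_smul, real_inner_smul_left, real_inner_smul_right, abs_mul, abs_mul,
        abs_of_pos (inv_pos.2 hp'), ← mul_assoc, ← sq, inv_pow, inv_mul_le_iff₀ (by positivity),
        mul_comm] at h1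
      exact h1
    obtain ⟨v, hv, hwv⟩ := hN w hw
    have hv1 := hN1 v hv
    -- The change equals `⟪A p, q⟫`. Weights `1/2` and `2` balance the factors: with `‖w - v‖ ≤ 1/2`
    -- they give `‖p‖² + ‖q‖² ≤ 31/16 < 2`, whereas equal weights would give `4`.
    set p := (1 / 2 : ℝ) • (w + v) with hp
    set q := (2 : ℝ) • (w - v) with hq
    have hsym : (inner ℝ (A w) v : ℝ) = inner ℝ (A v) w := by
      rw [real_inner_comm w]; exact hA w v
    have hpol : (inner ℝ (A w) w : ℝ) - inner ℝ (A v) v =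
        1 / 4 * (inner ℝ (A (p + q)) (p + q) - inner ℝ (A (p - q)) (p - q)) := by
      simp only [hp, hq, map_add, map_sub, map_smul, inner_add_left, inner_add_right,
        inner_sub_left, inner_sub_right, real_inner_smul_left, real_inner_smul_right, hsym]
      ring
    have hpar : ‖p + q‖ ^ 2 + ‖p - q‖ ^ 2 = 2 * (‖p‖ ^ 2 + ‖q‖ ^ 2) := by
      have := parallelogram_law_with_norm ℝ p q
      nlinarith
    have hpn : ‖p‖ ^ 2 = 1 / 4 * ‖w + v‖ ^ 2 := by
      rw [hp, norm_smul, mul_pow]; norm_num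
    have hqn : ‖q‖ ^ 2 = 4 * ‖w - v‖ ^ 2 := by
      rw [hq, norm_smul, mul_pow]; norm_num
    have hpar2 := parallelogram_law_with_norm ℝ w v
    rw [hw, hv1] at hpar2
    have hd : ‖w - v‖ ^ 2 ≤ 1 / 4 := by nlinarith [norm_nonneg (w - v)]
    have hR0 : 0 ≤ R := abs_nonneg _
    have h1 := abs_sub (inner ℝ (A (p + q)) (p + q)) (inner ℝ (A (p - q)) (p - q) : ℝ)
    have h2 : R ≤ |inner ℝ (A v) v| + |(inner ℝ (A w) w : ℝ) - inner ℝ (A v) v| := by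
      have := abs_add_le (inner ℝ (A v) v : ℝ) (inner ℝ (A w) w - inner ℝ (A v) v)
      rwa [add_sub_cancel] at this
    rw [hpol, abs_mul, abs_of_pos (by norm_num : (0 : ℝ) < 1 / 4)] at h2
    have h3 := hle (p + q)
    have h4 := hle (p - q)
    have h5 : ‖p‖ ^ 2 + ‖q‖ ^ 2 ≤ 31 / 16 := by nlinarith
    have h6 : R * (‖p + q‖ ^ 2 + ‖p - q‖ ^ 2) ≤ R * (31 / 8) :=
      mul_le_mul_of_nonneg_left (by linarith) hR0
    have h7 : R ≤ 32 * τ := by nlinarith [hτ v hv]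
    exact (hmax (mem_sphere_zero_iff_norm.2 hu)).trans h7
  rcases eq_or_ne u 0 with rfl | hu
  · simp
  have hu' : 0 < ‖u‖ := norm_pos_iff.2 hu
  have h1 := key (‖u‖⁻¹ • u) (by rw [norm_smul, norm_inv, norm_norm, inv_mul_cancel₀ hu'.ne'])
  rw [map_smul, real_inner_smul_left, real_inner_smul_right, abs_mul, abs_mul,
    abs_of_pos (inv_pos.2 hu'), ← mul_assoc, ← sq, inv_pow, inv_mul_le_iff₀ (by positivity),
    mul_comm] at h1
  exact h1

/-! ### Uniform concentration of weighted covariances -/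

/-- The quadratic form of the weighted empirical covariance
`(1/m) ∑ f(⟪aᵢ, e⟫) aᵢ aᵢᵀ`. -/
noncomputable def weightedForm {n m : ℕ} (f : ℝ → ℝ) (e : Vec n) (a : Fin m → Vec n)
    (u : Vec n) : ℝ :=
  1 / (m : ℝ) * ∑ i, f (inner ℝ (a i) e) * (inner ℝ (a i) u) ^ 2

/-- The expectation of `weightedForm` under a standard Gaussian design. -/
noncomputable def meanForm {n : ℕ} (f : ℝ → ℝ) (e u : Vec n) : ℝ :=
  (∫ t, f t ∂gaussianReal 0 1) * (‖u‖ ^ 2 - (inner ℝ u e) ^ 2) +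
    (∫ t, f t * t ^ 2 ∂gaussianReal 0 1) * (inner ℝ u e) ^ 2

theorem inner_sum_rankOne {n m : ℕ} (c : Fin m → ℝ) (a : Fin m → Vec n) (u v : Vec n) :
    inner ℝ (((1 / (m : ℝ)) • ∑ i, c i • InnerProductSpace.rankOne ℝ (a i) (a i) :
      Vec n →L[ℝ] Vec n) u) v =
      1 / (m : ℝ) * ∑ i, c i * (inner ℝ (a i) u * inner ℝ (a i) v) := by
  simp only [smul_apply, sum_apply, InnerProductSpace.rankOne_apply,
    real_inner_smul_left, sum_inner]

/-- Being the form of a symmetric operator is what lets control of the deviation pass from a net to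
all vectors. -/
theorem exists_isSymmetric_form {n m : ℕ} (f : ℝ → ℝ) (e : Vec n) (a : Fin m → Vec n) :
    ∃ A : Vec n →L[ℝ] Vec n, (A : Vec n →ₗ[ℝ] Vec n).IsSymmetric ∧
      ∀ u, inner ℝ (A u) u = weightedForm f e a u - meanForm f e u := by
  set b := ∫ t, f t ∂gaussianReal 0 1 with hb
  set b' := ∫ t, f t * t ^ 2 ∂gaussianReal 0 1 with hb'
  set A : Vec n →L[ℝ] Vec n :=
    (1 / (m : ℝ)) • (∑ i, f (inner ℝ (a i) e) • InnerProductSpace.rankOne ℝ (a i) (a i)) -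
    (b • ContinuousLinearMap.id ℝ _ + (b' - b) • InnerProductSpace.rankOne ℝ e e) with hA
  have key : ∀ u v, inner ℝ (A u) v = 1 / (m : ℝ) *
      ∑ i, f (inner ℝ (a i) e) * (inner ℝ (a i) u * inner ℝ (a i) v) -
      (b * inner ℝ u v + (b' - b) * (inner ℝ e u * inner ℝ e v)) := fun u v => by
    rw [hA, sub_apply, inner_sub_left, inner_sum_rankOne]
    simp only [add_apply, smul_apply, ContinuousLinearMap.id_apply, inner_add_left,
      real_inner_smul_left, InnerProductSpace.rankOne_apply]
  refine ⟨A, fun u v => ?_, fun u => ?_⟩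
  · simp only [ContinuousLinearMap.coe_coe]
    rw [key, real_inner_comm (A v) u, key, real_inner_comm u v]
    simp only [mul_comm]
  · rw [key, weightedForm, meanForm, real_inner_self_eq_norm_sq, real_inner_comm u e]
    simp only [← sq]
    ring

theorem measure_weightedForm_deviation_le {n m : ℕ} {Ω : Type*} [MeasurableSpace Ω]
    {P : Measure Ω} [IsProbabilityMeasure P] {a : Fin m → Ω → Vec n} (ha : IsGaussianDesign P a)
    {f : ℝ → ℝ} (hf : Measurable f) {B τ : ℝ} (hB : 0 < B) (hτ : 0 < τ) (hfB : ∀ t, |f t| ≤ B)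
    {e : Vec n} (he : ‖e‖ = 1) (hm : 0 < m) :
    P.real {ω | ¬ ∀ u : Vec n,
        |weightedForm f e (fun i => a i ω) u - meanForm f e u| ≤ 32 * τ * ‖u‖ ^ 2} ≤
      5 ^ n * (2 * Real.exp (-(deviationRate B τ * m))) := by
  obtain ⟨N, hN1, hcard, hN⟩ := exists_half_net_sphere n
  have hsub : {ω | ¬ ∀ u : Vec n,
        |weightedForm f e (fun i => a i ω) u - meanForm f e u| ≤ 32 * τ * ‖u‖ ^ 2} ⊆
      ⋃ v ∈ N, {ω | τ < |weightedForm f e (fun i => a i ω) v - meanForm f e v|} := by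
    intro ω hω
    by_contra hcon
    refine hω fun u => ?_
    simp only [Set.mem_iUnion, Set.mem_ofPred_eq, not_exists, not_lt] at hcon
    obtain ⟨A, hA, hAf⟩ := exists_isSymmetric_form f e (fun i => a i ω)
    rw [← hAf]
    refine abs_inner_le_of_half_net hA (N := N) hN1 hN (fun v hv => ?_) u
    rw [hAf]
    exact hcon v hv
  have hpt : ∀ v ∈ N, P.real {ω | τ < |weightedForm f e (fun i => a i ω) v - meanForm f e v|} ≤
      2 * Real.exp (-(deviationRate B τ * m)) := fun v hv => by
    have h := measure_abs_sub_le ha hB hτ (hN1 v hv)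
      (F := fun b => f (inner ℝ b e) * (inner ℝ b v) ^ 2) (by fun_prop) (fun b => by
        rw [abs_mul, abs_of_nonneg (sq_nonneg (inner ℝ b v : ℝ))]
        exact mul_le_mul_of_nonneg_right (hfB _) (sq_nonneg _)) hm
    rwa [integral_mul_inner_sq he hf hfB] at h
  calc _ ≤ _ := measureReal_mono hsub (measure_ne_top _ _)
    _ ≤ ∑ v ∈ N, P.real {ω | τ < |weightedForm f e (fun i => a i ω) v - meanForm f e v|} :=
      measureReal_biUnion_finset_le _ _
    _ ≤ ∑ _v ∈ N, 2 * Real.exp (-(deviationRate B τ * m)) := Finset.sum_le_sum hpt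
    _ = N.card * (2 * Real.exp (-(deviationRate B τ * m))) := by simp
    _ ≤ _ := by
      gcongr
      exact_mod_cast hcard

/-! ### Truncated weights: spectral gap and effect of noise -/

/-- The truncated square `t² 1{t² ≤ α²}`. -/
noncomputable def truncSq (α t : ℝ) : ℝ := if t ^ 2 ≤ α ^ 2 then t ^ 2 else 0

/-- The indicator of the band `|t² - α²| ≤ 15 α² τ` around the truncation level. -/
noncomputable def bandInd (α τ t : ℝ) : ℝ := if |t ^ 2 - α ^ 2| ≤ 15 * α ^ 2 * τ then 1 else 0

/-- A majorant of the effect of noise of relative size `τ` on the truncated square. -/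
noncomputable def noiseWeight (α τ t : ℝ) : ℝ := τ * α ^ 2 + 3 * α ^ 2 * bandInd α τ t

theorem measurable_truncSq (α : ℝ) : Measurable (truncSq α) :=
  Measurable.ite (measurableSet_le (by fun_prop) (by fun_prop)) (by fun_prop) (by fun_prop)

theorem abs_truncSq_le (α t : ℝ) : |truncSq α t| ≤ α ^ 2 := by
  unfold truncSq
  split_ifs with h
  · rwa [abs_of_nonneg (sq_nonneg t)]
  · simpa using sq_nonneg α

theorem measurableSet_band (α τ : ℝ) :
    MeasurableSet {t : ℝ | |t ^ 2 - α ^ 2| ≤ 15 * α ^ 2 * τ} :=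
  measurableSet_le (by fun_prop) (by fun_prop)

theorem measurable_bandInd (α τ : ℝ) : Measurable (bandInd α τ) :=
  Measurable.ite (measurableSet_band α τ) (by fun_prop) (by fun_prop)

theorem bandInd_nonneg (α τ t : ℝ) : 0 ≤ bandInd α τ t := by
  unfold bandInd; split_ifs <;> norm_num

theorem bandInd_le_one (α τ t : ℝ) : bandInd α τ t ≤ 1 := by
  unfold bandInd; split_ifs <;> norm_num

theorem measurable_noiseWeight (α τ : ℝ) : Measurable (noiseWeight α τ) :=
  ((measurable_bandInd α τ).const_mul _).const_add _

theorem noiseWeight_nonneg {α τ : ℝ} (hτ : 0 ≤ τ) (t : ℝ) : 0 ≤ noiseWeight α τ t := by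
  have := bandInd_nonneg α τ t
  unfold noiseWeight
  positivity

theorem abs_noiseWeight_le {α τ : ℝ} (hτ : 0 ≤ τ) (hτ1 : τ ≤ 1) (t : ℝ) :
    |noiseWeight α τ t| ≤ 4 * α ^ 2 := by
  rw [abs_of_nonneg (noiseWeight_nonneg hτ t), noiseWeight]
  nlinarith [sq_nonneg α, bandInd_le_one α τ t]

/-- With `s = t²`, a polynomial minorant replaces the truncated integral. Below the cut the
difference is `(s³ - s² + 1)/9 ≥ 0`; above it the minorant is `-(s(s-1)(s-9) + 1)/9`, negative
because `s > α² ≥ 9`. The moments `1, 3, 15` give it mean `5/9`. -/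
theorem half_le_integral_truncSq {α : ℝ} (hα : 3 ≤ α) :
    1 / 2 ≤ ∫ t, truncSq α t * t ^ 2 ∂gaussianReal 0 1 - ∫ t, truncSq α t ∂gaussianReal 0 1 := by
  have i1 := integrable_bounded_mul_pow (measurable_truncSq α) (abs_truncSq_le α) 2
  have i2 := integrable_bounded_mul_pow (measurable_truncSq α) (abs_truncSq_le α) 0
  simp only [pow_zero, mul_one] at i2
  have j2 := integrable_pow_gaussianReal 2
  have j4 := (integrable_pow_gaussianReal 4).const_mul (10 / 9)
  have j6 := (integrable_pow_gaussianReal 6).const_mul (1 / 9)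
  have k1 : Integrable (fun t : ℝ => 10 / 9 * t ^ 4 - t ^ 2) (gaussianReal 0 1) := j4.sub j2
  have k2 : Integrable (fun t : ℝ => 10 / 9 * t ^ 4 - t ^ 2 - 1 / 9 * t ^ 6) (gaussianReal 0 1) :=
    k1.sub j6
  rw [← integral_sub i1 i2]
  have hle : ∫ t : ℝ, (10 / 9 * t ^ 4 - t ^ 2 - 1 / 9 * t ^ 6 - 1 / 9) ∂gaussianReal 0 1 ≤
      ∫ t, (truncSq α t * t ^ 2 - truncSq α t) ∂gaussianReal 0 1 := by
    refine integral_mono (k2.sub (integrable_const _)) (i1.sub i2) fun t => ?_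
    simp only [truncSq]
    have h9 : (9 : ℝ) ≤ α ^ 2 := by nlinarith
    have ht := sq_nonneg t
    have e4 : t ^ 4 = (t ^ 2) ^ 2 := by ring
    have e6 : t ^ 6 = (t ^ 2) ^ 3 := by ring
    rw [e4, e6]
    generalize t ^ 2 = s at ht ⊢
    split_ifs with h
    · rcases le_total s 1 with h1 | h1
      · nlinarith [mul_nonneg ht ht, mul_nonneg (mul_nonneg ht ht) ht, mul_nonneg ht (sub_nonneg.2 h1)]
      · nlinarith [mul_nonneg (mul_nonneg ht ht) (sub_nonneg.2 h1)]
    · have h1 : 9 ≤ s := by linarith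
      nlinarith [mul_nonneg (mul_nonneg ht (by linarith : (0 : ℝ) ≤ s - 1)) (sub_nonneg.2 h1)]
  refine le_trans ?_ hle
  rw [integral_sub k2 (integrable_const _), integral_sub k1 j6,
    integral_sub j4 j2, integral_const_mul, integral_const_mul, integral_sq_gaussianReal,
    integral_pow_four_gaussianReal, integral_pow_six_gaussianReal]
  simp
  norm_num

/-- The bands shrink to the null set `{α, -α}`, so continuity from above applies. -/
theorem exists_band_measure_le {α : ℝ} (hα : 0 < α) {κ : ℝ} (hκ : 0 < κ) :
    ∃ τ₀ : ℝ, 0 < τ₀ ∧ ∀ τ ≤ τ₀,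
      (gaussianReal 0 1).real {t : ℝ | |t ^ 2 - α ^ 2| ≤ 15 * α ^ 2 * τ} ≤ κ := by
  set S : ℕ → Set ℝ := fun k => {t : ℝ | |t ^ 2 - α ^ 2| ≤ 15 * α ^ 2 * (1 / ((k : ℝ) + 1))} with hS
  have hanti : Antitone S := fun i j hij t ht => by
    simp only [hS, Set.mem_ofPred_eq] at ht ⊢
    exact ht.trans (mul_le_mul_of_nonneg_left (Nat.one_div_le_one_div hij) (by positivity))
  have hinter : ⋂ k, S k ⊆ {α, -α} := by
    intro t ht
    have h0 : |t ^ 2 - α ^ 2| ≤ 0 := by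
      have hlim := (tendsto_one_div_add_atTop_nhds_zero_nat (𝕜 := ℝ)).const_mul (15 * α ^ 2)
      rw [mul_zero] at hlim
      exact ge_of_tendsto' hlim fun k => Set.mem_iInter.1 ht k
    have h1 : t ^ 2 = α ^ 2 := by
      have := abs_nonpos_iff.1 h0
      linarith
    simpa using sq_eq_sq_iff_eq_or_eq_neg.1 h1
  have hzero : gaussianReal 0 1 (⋂ k, S k) = 0 := by
    refine measure_mono_null hinter ?_
    exact (gaussianReal_absolutelyContinuous 0 one_ne_zero) (by
      exact (Set.toFinite {α, -α}).measure_zero volume)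
  have hlim := tendsto_measure_iInter_atTop (μ := gaussianReal 0 1) (s := S)
    (fun k => (measurableSet_band α _).nullMeasurableSet) hanti ⟨0, measure_ne_top _ _⟩
  rw [hzero] at hlim
  obtain ⟨k, hk⟩ := (hlim.eventually (gt_mem_nhds (ENNReal.ofReal_pos.2 hκ))).exists
  refine ⟨1 / ((k : ℝ) + 1), by positivity, fun τ hτ => ?_⟩
  refine (measureReal_mono (s₂ := S k) (fun t ht => ?_) (measure_ne_top _ _)).trans
    (ENNReal.toReal_le_of_le_ofReal hκ.le hk.le)
  simp only [hS, Set.mem_ofPred_eq] at ht ⊢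
  exact ht.trans (mul_le_mul_of_nonneg_left hτ (by positivity))

theorem meanForm_le {n : ℕ} {f : ℝ → ℝ} {κ : ℝ} (h1 : ∫ t, f t ∂gaussianReal 0 1 ≤ κ)
    (h2 : ∫ t, f t * t ^ 2 ∂gaussianReal 0 1 ≤ κ) {e : Vec n} (he : ‖e‖ = 1) (u : Vec n) :
    meanForm f e u ≤ κ * ‖u‖ ^ 2 := by
  have hc : (inner ℝ u e : ℝ) ^ 2 ≤ ‖u‖ ^ 2 := by
    have := abs_real_inner_le_norm u e
    rw [he, mul_one] at this
    exact sq_le_sq' (by linarith [neg_abs_le (inner ℝ u e : ℝ)]) ((le_abs_self _).trans this)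
  unfold meanForm
  nlinarith [mul_le_mul_of_nonneg_right h1 (sub_nonneg.2 hc),
    mul_le_mul_of_nonneg_right h2 (sq_nonneg (inner ℝ u e : ℝ))]

theorem exists_noiseWeight_small {α : ℝ} (hα : 1 ≤ α) {κ : ℝ} (hκ : 0 < κ) :
    ∃ τ₀ : ℝ, 0 < τ₀ ∧ ∀ τ, 0 < τ → τ ≤ τ₀ →
      ∫ t, noiseWeight α τ t ∂gaussianReal 0 1 ≤ κ ∧
      ∫ t, noiseWeight α τ t * t ^ 2 ∂gaussianReal 0 1 ≤ κ := by
  have hα0 : 0 < α := by linarith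
  -- For `τ ≤ 1/15` the band lies in `t² ≤ 2α²`, so its share of the second integral is at most `3α²
  -- · 2α² · p ≤ κ/2`; the constant part `τα²` takes the other half.
  obtain ⟨τ₁, hτ₁, hband⟩ := exists_band_measure_le hα0 (κ := κ / (12 * α ^ 4)) (by positivity)
  refine ⟨min τ₁ (min (1 / 15) (κ / (2 * α ^ 2))), by positivity, fun τ hτ hτle => ?_⟩
  have hp := hband τ (hτle.trans (min_le_left _ _))
  have h15 : τ ≤ 1 / 15 := hτle.trans ((min_le_right _ _).trans (min_le_left _ _))
  have hκτ : τ * α ^ 2 ≤ κ / 2 := by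
    have := hτle.trans ((min_le_right _ _).trans (min_le_right _ _))
    rw [le_div_iff₀ (by positivity)] at this
    linarith
  set p := (gaussianReal 0 1).real {t : ℝ | |t ^ 2 - α ^ 2| ≤ 15 * α ^ 2 * τ} with hpdef
  have hp0 : 0 ≤ p := measureReal_nonneg
  rw [le_div_iff₀ (by positivity)] at hp
  have hα2 : 1 ≤ α ^ 2 := by nlinarith
  have hα4 : α ^ 2 ≤ α ^ 4 := by nlinarith
  have hbabs : ∀ t, |bandInd α τ t| ≤ 1 := fun t => by
    rw [abs_of_nonneg (bandInd_nonneg _ _ _)]; exact bandInd_le_one _ _ _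
  have i2 := integrable_bounded_mul_pow (measurable_bandInd α τ) hbabs 2
  have i0 := integrable_bounded_mul_pow (measurable_bandInd α τ) hbabs 0
  simp only [pow_zero, mul_one] at i0
  have hb : ∫ t, bandInd α τ t ∂gaussianReal 0 1 = p := by
    rw [hpdef, ← integral_indicator_one (measurableSet_band α τ)]
    rfl
  have hb2 : ∫ t, bandInd α τ t * t ^ 2 ∂gaussianReal 0 1 ≤ 2 * α ^ 2 * p := by
    rw [← hb, ← integral_const_mul]
    refine integral_mono i2 (i0.const_mul _) fun t => ?_
    simp only [bandInd]
    split_ifs with h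
    · have := (abs_le.1 h).2
      nlinarith
    · simp
  constructor
  · unfold noiseWeight
    rw [integral_add (integrable_const _) (i0.const_mul _), integral_const_mul (3 * α ^ 2), hb]
    simp only [integral_const, probReal_univ, smul_eq_mul, one_mul]
    nlinarith
  · have hs : ∀ t, noiseWeight α τ t * t ^ 2 =
        τ * α ^ 2 * t ^ 2 + 3 * α ^ 2 * (bandInd α τ t * t ^ 2) := fun t => by
      unfold noiseWeight; ring
    simp_rw [hs]
    rw [integral_add ((integrable_pow_gaussianReal 2).const_mul _) (i2.const_mul _),
      integral_const_mul, integral_const_mul, integral_sq_gaussianReal]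
    have : 3 * α ^ 2 * ∫ t, bandInd α τ t * t ^ 2 ∂gaussianReal 0 1 ≤
        3 * α ^ 2 * (2 * α ^ 2 * p) := mul_le_mul_of_nonneg_left hb2 (by positivity)
    nlinarith

/-- The threshold moves by at most `4τα²`. Off the band, the margin `15τα²` exceeds this plus the
noise, so both truncations decide alike and only a noise of at most `τα²` remains. On the band, the
two terms are bounded separately, by `α² + 4τα²` and `α²`. -/
theorem abs_truncated_sub_truncSq_le {α τ g η L : ℝ} (hα : 1 ≤ α) (hτ : 0 < τ) (hτ1 : τ ≤ 1 / 15)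
    (hη : |η| ≤ τ * max 1 (g ^ 2)) (hL : |L - 1| ≤ 4 * τ) :
    |(if |g ^ 2 + η| ≤ α ^ 2 * L then g ^ 2 + η else 0) - truncSq α g| ≤ noiseWeight α τ g := by
  obtain ⟨hL1, hL2⟩ := abs_le.1 hL
  obtain ⟨hη1, hη2⟩ := abs_le.1 hη
  have hα2 : 1 ≤ α ^ 2 := by nlinarith
  have hg := sq_nonneg g
  have hτα : 0 < τ * α ^ 2 := by positivity
  have hLlow : α ^ 2 - 4 * (τ * α ^ 2) ≤ α ^ 2 * L := by nlinarith
  have hLup : α ^ 2 * L ≤ α ^ 2 + 4 * (τ * α ^ 2) := by nlinarith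
  have hτα1 : 15 * (τ * α ^ 2) ≤ α ^ 2 := by nlinarith
  unfold noiseWeight bandInd truncSq
  generalize g ^ 2 = s at *
  by_cases hband : |s - α ^ 2| ≤ 15 * α ^ 2 * τ
  · rw [if_pos hband]
    have h1 : |if |s + η| ≤ α ^ 2 * L then s + η else 0| ≤ α ^ 2 + 4 * (τ * α ^ 2) := by
      split_ifs with h
      · linarith
      · rw [abs_zero]; positivity
    have h2 : |if s ≤ α ^ 2 then s else 0| ≤ α ^ 2 := by
      split_ifs with h
      · rwa [abs_of_nonneg hg]
      · rw [abs_zero]; positivity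
    exact (abs_sub _ _).trans (by linarith)
  · rw [if_neg hband]
    rcases lt_abs.1 (not_le.1 hband) with h | h
    · have hmax : max 1 s = s := max_eq_right (by nlinarith)
      rw [hmax] at hη1
      have hbig : α ^ 2 * L < s + η := by nlinarith
      rw [if_neg (not_le.2 (hbig.trans_le (le_abs_self _))), if_neg (by nlinarith)]
      simpa using hτα.le
    · have hmax : max 1 s ≤ α ^ 2 := max_le hα2 (by nlinarith)
      have hη3 : |η| ≤ τ * α ^ 2 := hη.trans (mul_le_mul_of_nonneg_left hmax hτ.le)
      have hsmall : |s + η| ≤ α ^ 2 * L := by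
        refine (abs_add_le _ _).trans ?_
        rw [abs_of_nonneg hg]
        nlinarith
      rw [if_pos hsmall, if_pos (by nlinarith)]
      simpa using hη3

/-! ### Leading eigenvectors, scale factors and deterministic accuracy -/

/-- In finite dimension the supremum of the Rayleigh quotient is itself an eigenvalue, hence at most
the one belonging to `v`. -/
theorem inner_apply_le_of_isLeadingEigenvector {n : ℕ} {T : Vec n →L[ℝ] Vec n}
    (hT : (T : Vec n →ₗ[ℝ] Vec n).IsSymmetric) {v : Vec n} (hv : IsLeadingEigenvector T v)
    {w : Vec n} (hw : ‖w‖ = 1) : inner ℝ (T w) w ≤ inner ℝ (T v) v := by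
  obtain ⟨hv1, μ, hμ, hmax⟩ := hv
  have hw0 : w ≠ 0 := fun h => by simp [h] at hw
  have : Nontrivial (Vec n) := ⟨w, 0, hw0⟩
  have hsup := hmax _ hT.hasEigenvalue_iSup_of_finiteDimensional
  have hbdd : BddAbove (Set.range fun x : {x : Vec n // x ≠ 0} =>
      (RCLike.re (inner ℝ ((T : Vec n →ₗ[ℝ] Vec n) x) (x : Vec n)) / ‖(x : Vec n)‖ ^ 2 : ℝ)) := by
    refine ⟨‖T‖, ?_⟩
    rintro _ ⟨⟨x, hx⟩, rfl⟩
    have hx' : 0 < ‖x‖ := norm_pos_iff.2 hx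
    simp only [ContinuousLinearMap.coe_coe, RCLike.re_to_real]
    rw [div_le_iff₀ (by positivity)]
    calc (inner ℝ (T x) x : ℝ) ≤ ‖T x‖ * ‖x‖ := real_inner_le_norm _ _
      _ ≤ ‖T‖ * ‖x‖ * ‖x‖ := by gcongr; exact T.le_opNorm x
      _ = ‖T‖ * ‖x‖ ^ 2 := by ring
  have h1 := (le_ciSup hbdd ⟨w, hw0⟩).trans hsup
  simp only [ContinuousLinearMap.coe_coe, RCLike.re_to_real, hw, one_pow, div_one] at h1
  have h2 : T v = μ • v := hμ.apply_eq_smul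
  rw [h2, real_inner_smul_left, real_inner_self_eq_norm_sq, hv1]
  linarith

theorem isSymmetric_truncatedY {n m : ℕ} (α : ℝ) (a : Fin m → Vec n) (y : Fin m → ℝ) :
    (truncatedY α a y : Vec n →ₗ[ℝ] Vec n).IsSymmetric := fun u v => by
  simp only [ContinuousLinearMap.coe_coe]
  rw [truncatedY, inner_sum_rankOne, real_inner_comm _ u, inner_sum_rankOne]
  simp only [mul_comm (inner ℝ (a _) u : ℝ)]

/-- After choosing the sign so that `c = ⟪v, e⟫ ≥ 0`, one has `‖v - e‖² = 2(1 - c) ≤ 2(1 - c²) ≤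
(δ/2)²`. Direction and length each contribute an error of at most `δr/2`. -/
theorem signDist_smul_le {n : ℕ} {v e : Vec n} (hv : ‖v‖ = 1) (he : ‖e‖ = 1) {r s δ : ℝ}
    (hr : 0 ≤ r) (hδ : 0 ≤ δ) (hs : |s - r| ≤ δ / 2 * r)
    (hc : 8 * (1 - (inner ℝ v e) ^ 2) ≤ δ ^ 2) : signDist (s • v) (r • e) ≤ δ * r := by
  have key : ∀ v' : Vec n, ‖v'‖ = 1 → (inner ℝ v' e : ℝ) ^ 2 = (inner ℝ v e) ^ 2 →
      0 ≤ (inner ℝ v' e : ℝ) → ‖s • v' - r • e‖ ≤ δ * r := by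
    intro v' hv' hsq h0
    have h1 : (inner ℝ v' e : ℝ) ≤ 1 := by
      have := real_inner_le_norm v' e
      rwa [hv', he, mul_one] at this
    have h2 : ‖v' - e‖ ^ 2 ≤ (δ / 2) ^ 2 := by
      rw [norm_sub_sq_real, hv', he]
      nlinarith
    have h3 : ‖v' - e‖ ≤ δ / 2 := by
      exact (le_abs_self _).trans (abs_le_of_sq_le_sq h2 (by positivity))
    have h4 : s • v' - r • e = (s - r) • v' + r • (v' - e) := by
      rw [sub_smul, smul_sub]; abel
    rw [h4]
    refine (norm_add_le _ _).trans ?_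
    rw [norm_smul, norm_smul, hv', mul_one, Real.norm_eq_abs, Real.norm_eq_abs, abs_of_nonneg hr]
    nlinarith
  unfold signDist
  rcases le_total 0 (inner ℝ v e : ℝ) with h | h
  · exact (min_le_left _ _).trans (key v hv rfl h)
  · refine (min_le_right _ _).trans ?_
    have := key (-v) (by rwa [norm_neg]) (by rw [inner_neg_left, neg_sq])
      (by rw [inner_neg_left]; linarith)
    rwa [smul_neg, ← neg_add', norm_neg] at this

theorem abs_sub_one_le_of_sq_mul_eq_one {d q τ : ℝ} (hd : 0 ≤ d) (hdq : d ^ 2 * q = 1)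
    (hτ : τ ≤ 1 / 2) (hq : |q - 1| ≤ τ) : |d - 1| ≤ 2 * τ := by
  obtain ⟨h1, h2⟩ := abs_le.1 hq
  have hq0 : 1 / 2 ≤ q := by linarith
  have hτ0 : 0 ≤ τ := (abs_nonneg _).trans hq
  rw [abs_le]
  constructor
  · by_contra! h
    nlinarith [mul_nonneg hd (by linarith : 0 ≤ q)]
  · by_contra! h
    nlinarith [mul_nonneg hd (by linarith : 0 ≤ q)]

theorem abs_sqrt_sub_one_le {L τ : ℝ} (hL0 : 0 ≤ L) (hL : |L - 1| ≤ τ) : |√L - 1| ≤ τ := by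
  have h1 : |√L - 1| * (√L + 1) = |L - 1| := by
    have h2 : L - 1 = (√L - 1) * (√L + 1) := by
      have := Real.sq_sqrt hL0
      linarith
    rw [h2, abs_mul, abs_of_pos (by positivity : 0 < √L + 1)]
  have h2 := abs_nonneg (√L - 1)
  have h3 := Real.sqrt_nonneg L
  nlinarith

/-- Summing the weight-`1` form over an orthonormal basis gives the mean of `‖aᵢ‖²`, so the design
scale needs no event of its own. -/
theorem abs_designScale_sub_one_le {n m : ℕ} (hn : 0 < n) (hm : 0 < m) {e : Vec n}
    {a : Fin m → Vec n} {τ : ℝ} (hτ : τ ≤ 1 / 2)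
    (h : ∀ u : Vec n, |weightedForm (fun _ => 1) e a u - ‖u‖ ^ 2| ≤ τ * ‖u‖ ^ 2) :
    |designScale a - 1| ≤ 2 * τ := by
  have hn' : (0 : ℝ) < n := by exact_mod_cast hn
  have hm' : (0 : ℝ) < m := by exact_mod_cast hm
  set S := ∑ i, ‖a i‖ ^ 2 with hS
  set b := EuclideanSpace.basisFun (Fin n) ℝ
  have hsum : S / m = ∑ j, weightedForm (fun _ => 1) e a (b j) := by
    simp only [weightedForm, one_mul]
    rw [← Finset.mul_sum, Finset.sum_comm, hS]
    have : ∀ i, ∑ j, (inner ℝ (a i) (b j) : ℝ) ^ 2 = ‖a i‖ ^ 2 := fun i =>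
      b.sum_sq_inner_left (a i)
    simp_rw [this]
    ring
  have hdev : |S / m - n| ≤ τ * n := by
    have h1 : S / m - n = ∑ j, (weightedForm (fun _ => 1) e a (b j) - 1) := by
      rw [hsum, Finset.sum_sub_distrib]; simp
    rw [h1]
    refine (Finset.abs_sum_le_sum_abs _ _).trans ?_
    calc _ ≤ ∑ _j : Fin n, τ := Finset.sum_le_sum fun j _ => by
          simpa using h (b j)
      _ = τ * n := by simp [mul_comm]
  have hq : |S / (m * n) - 1| ≤ τ := by
    have h1 : S / (m * n) - 1 = (S / m - n) / n := by field_simp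
    rw [h1, abs_div, abs_of_pos hn', div_le_iff₀ hn']
    exact hdev
  have hqpos : 0 < S / (m * n) := by
    have := (abs_le.1 hq).1
    linarith
  have hSpos : 0 < S := (div_pos_iff_of_pos_right (by positivity)).1 hqpos
  refine abs_sub_one_le_of_sq_mul_eq_one (Real.sqrt_nonneg _) ?_ hτ hq
  rw [designScale, ← hS, Real.sq_sqrt (by positivity)]
  field_simp

/-- The deterministic accuracy statement: on the event where the three weighted covariances are
close to their means, every truncated spectral estimate is accurate. -/
theorem signDist_le_of_good_design {n m : ℕ} (hn : 0 < n) (hm : 0 < m) {α τ κ δ r : ℝ}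
    (hα : 3 ≤ α) (hδ : 0 ≤ δ) (hτ : 0 < τ) (hτ1 : τ ≤ 1 / 15) (hr : 0 < r) {e : Vec n}
    (he : ‖e‖ = 1) (a : Fin m → Vec n) (η : Fin m → ℝ)
    (h1 : ∀ u : Vec n, |weightedForm (fun _ => 1) e a u - ‖u‖ ^ 2| ≤ τ * ‖u‖ ^ 2)
    (hF : ∀ u : Vec n, |weightedForm (truncSq α) e a u - meanForm (truncSq α) e u| ≤
      τ * ‖u‖ ^ 2)
    (hW : ∀ u : Vec n, weightedForm (noiseWeight α τ) e a u ≤ κ * ‖u‖ ^ 2)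
    (hτδ : 16 * τ ≤ δ) (hκδ : 32 * (τ + κ) ≤ δ ^ 2)
    (hη : NoiseBound τ a (r • e) η) {z : Vec n}
    (hz : IsTruncatedSpectralEstimate α a (fun i => intensity a (r • e) i + η i) z) :
    signDist z (r • e) ≤ δ * r := by
  have hm' : (0 : ℝ) < m := by exact_mod_cast hm
  set g : Fin m → ℝ := fun i => inner ℝ (a i) e with hg
  set η' : Fin m → ℝ := fun i => η i / r ^ 2 with hη'
  have hint : ∀ i, intensity a (r • e) i = r ^ 2 * g i ^ 2 := fun i => by
    rw [intensity, real_inner_smul_right, mul_pow]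
  have hre : ‖r • e‖ = r := by rw [norm_smul, he, mul_one, Real.norm_eq_abs, abs_of_pos hr]
  have hη1 : ∀ i, |η' i| ≤ τ * max 1 (g i ^ 2) := fun i => by
    have := hη i
    rw [hint, hre] at this
    rw [hη', abs_div, abs_of_pos (by positivity : 0 < r ^ 2), div_le_iff₀ (by positivity),
      mul_assoc, max_mul_of_nonneg _ _ (by positivity), one_mul, mul_comm (g i ^ 2)]
    exact this
  set y : Fin m → ℝ := fun i => intensity a (r • e) i + η i with hy
  have hyr : ∀ i, y i = r ^ 2 * (g i ^ 2 + η' i) := fun i => by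
    simp only [hy, hint, hη']
    field_simp
  set L := empMean (fun i => g i ^ 2 + η' i) with hL
  have hmean : empMean y = r ^ 2 * L := by
    simp only [hL, empMean, hyr, ← Finset.mul_sum]
    ring
  have hG : |1 / (m : ℝ) * ∑ i, g i ^ 2 - 1| ≤ τ := by
    have := h1 e
    simpa [weightedForm, he, hg] using this
  -- The Gaussian mean is off by `τ` and the noise adds at most `τ(2 + τ)`.
  have hL1 : |L - 1| ≤ 4 * τ := by
    have hsplit : L - 1 = (1 / (m : ℝ) * ∑ i, g i ^ 2 - 1) + 1 / (m : ℝ) * ∑ i, η' i := by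
      simp only [hL, empMean, Finset.sum_add_distrib]; ring
    have hηsum : |1 / (m : ℝ) * ∑ i, η' i| ≤ τ * (1 + 1 / (m : ℝ) * ∑ i, g i ^ 2) := by
      rw [abs_mul, abs_of_pos (by positivity : 0 < 1 / (m : ℝ))]
      calc 1 / (m : ℝ) * |∑ i, η' i| ≤ 1 / (m : ℝ) * ∑ i, τ * (1 + g i ^ 2) := by
            gcongr
            refine (Finset.abs_sum_le_sum_abs _ _).trans (Finset.sum_le_sum fun i _ => ?_)
            refine (hη1 i).trans (mul_le_mul_of_nonneg_left ?_ hτ.le)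
            exact max_le (by nlinarith [sq_nonneg (g i)]) (by linarith)
        _ = τ * (1 + 1 / (m : ℝ) * ∑ i, g i ^ 2) := by
            rw [← Finset.mul_sum, Finset.sum_add_distrib]
            simp
            field_simp
    rw [hsplit]
    refine (abs_add_le _ _).trans ?_
    have := (abs_le.1 hG).2
    nlinarith
  have hL0 : 0 ≤ L := by
    have := (abs_le.1 hL1).1
    linarith
  have hlam : lambdaZero y = r * √L := by
    rw [lambdaZero, hmean, Real.sqrt_mul (by positivity), Real.sqrt_sq hr.le]
  have hsqrt := abs_sqrt_sub_one_le hL0 hL1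
  have hdes := abs_designScale_sub_one_le hn hm (by linarith) h1
  obtain ⟨v, hv, hzv⟩ := hz
  have hquad : ∀ u : Vec n, |inner ℝ (truncatedY α a y u) u / r ^ 2 -
      meanForm (truncSq α) e u| ≤ (τ + κ) * ‖u‖ ^ 2 := by
    intro u
    set H : Fin m → ℝ := fun i => if |g i ^ 2 + η' i| ≤ α ^ 2 * L then g i ^ 2 + η' i else 0
    have hY : inner ℝ (truncatedY α a y u) u / r ^ 2 =
        1 / (m : ℝ) * ∑ i, H i * (inner ℝ (a i) u) ^ 2 := by
      rw [truncatedY, inner_sum_rankOne]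
      have hH : ∀ i, (if |y i| ≤ α ^ 2 * empMean y then y i else 0) = r ^ 2 * H i := fun i => by
        have hiff : |y i| ≤ α ^ 2 * empMean y ↔ |g i ^ 2 + η' i| ≤ α ^ 2 * L := by
          rw [hyr, hmean, abs_mul, abs_of_pos (by positivity : 0 < r ^ 2), mul_left_comm]
          exact mul_le_mul_iff_right₀ (by positivity)
        by_cases h : |g i ^ 2 + η' i| ≤ α ^ 2 * L
        · rw [if_pos (hiff.2 h), hyr]
          simp only [H, if_pos h]
        · rw [if_neg (mt hiff.1 h)]
          simp only [H, if_neg h, mul_zero]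
      simp only [hH, mul_assoc, ← Finset.mul_sum, ← sq]
      field_simp
    have hdiff : |1 / (m : ℝ) * ∑ i, H i * (inner ℝ (a i) u) ^ 2 -
        weightedForm (truncSq α) e a u| ≤ weightedForm (noiseWeight α τ) e a u := by
      rw [weightedForm, ← mul_sub, ← Finset.sum_sub_distrib, abs_mul,
        abs_of_pos (by positivity : 0 < 1 / (m : ℝ)), weightedForm]
      gcongr
      refine (Finset.abs_sum_le_sum_abs _ _).trans (Finset.sum_le_sum fun i _ => ?_)
      rw [← sub_mul, abs_mul, abs_of_nonneg (sq_nonneg (inner ℝ (a i) u : ℝ))]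
      exact mul_le_mul_of_nonneg_right
        (abs_truncated_sub_truncSq_le (by linarith) hτ hτ1 (hη1 i) hL1) (sq_nonneg _)
    rw [hY]
    calc _ ≤ _ := abs_sub_le _ (weightedForm (truncSq α) e a u) _
      _ ≤ κ * ‖u‖ ^ 2 + τ * ‖u‖ ^ 2 := add_le_add (hdiff.trans (hW u)) (hF u)
      _ = _ := by ring
  have hv1 := hv.1
  have hray := inner_apply_le_of_isLeadingEigenvector (isSymmetric_truncatedY α a y) hv he
  have hray' : inner ℝ (truncatedY α a y e) e / r ^ 2 ≤ inner ℝ (truncatedY α a y v) v / r ^ 2 :=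
    div_le_div_of_nonneg_right hray (by positivity)
  have hqe := (abs_le.1 (hquad e)).1
  have hqv := (abs_le.1 (hquad v)).2
  have hgap := half_le_integral_truncSq hα
  have hee : (inner ℝ e e : ℝ) = 1 := by rw [real_inner_self_eq_norm_sq, he, one_pow]
  simp only [meanForm, he, hv1, hee, one_pow, mul_one] at hqe hqv
  have hc1 : (inner ℝ v e : ℝ) ^ 2 ≤ 1 := by
    have := abs_real_inner_le_norm v e
    rw [he, hv1, mul_one] at this
    rw [← sq_abs]
    exact pow_le_one₀ (abs_nonneg _) this
  -- The form at `v` is at least the form at `e`; replacing both by their means costs `2(τ + κ)`, so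
  -- `(1 - ⟪v, e⟫²)/2 ≤ 2(τ + κ)`.
  have hcos : 8 * (1 - (inner ℝ v e : ℝ) ^ 2) ≤ δ ^ 2 := by
    have := mul_le_mul_of_nonneg_right hgap (sub_nonneg.2 hc1)
    nlinarith
  have hscale : ∀ σ : ℝ, |σ - 1| ≤ 8 * τ → signDist ((r * σ) • v) (r • e) ≤ δ * r := fun σ hσ => by
    refine signDist_smul_le hv1 he hr.le hδ ?_ hcos
    have : r * σ - r = (σ - 1) * r := by ring
    rw [this, abs_mul, abs_of_pos hr]
    exact mul_le_mul_of_nonneg_right (by linarith) hr.le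
  rcases hzv with rfl | rfl
  · have : designScale a * lambdaZero y = r * (designScale a * √L) := by rw [hlam]; ring
    rw [this]
    refine hscale _ ?_
    have hs : designScale a * √L - 1 = (designScale a - 1) * √L + (√L - 1) := by ring
    rw [hs]
    refine (abs_add_le _ _).trans ?_
    rw [abs_mul, abs_of_nonneg (Real.sqrt_nonneg L)]
    have := (abs_le.1 hsqrt).2
    nlinarith [abs_nonneg (designScale a - 1), Real.sqrt_nonneg L]
  · rw [hlam]
    exact hscale _ (hsqrt.trans (by linarith))

/-! ### Poisson deviations and the noise bound -/

theorem integrable_exp_mul_poissonMeasure (r : NNReal) (s : ℝ) :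
    Integrable (fun k : ℕ => Real.exp (s * k)) (poissonMeasure r) := by
  rw [integrable_poissonMeasure_iff]
  have h := ((Real.summable_pow_div_factorial (r * Real.exp s)).mul_left (Real.exp (-r)))
  refine h.congr fun k => ?_
  rw [Real.norm_eq_abs, Real.abs_exp, mul_comm s, Real.exp_nat_mul, mul_pow]
  ring

theorem mgf_poissonMeasure (r : NNReal) (s : ℝ) :
    mgf (fun k : ℕ => (k : ℝ)) (poissonMeasure r) s = Real.exp (r * (Real.exp s - 1)) := by
  rw [mgf, integral_poissonMeasure]
  have h : ∀ k : ℕ, (Real.exp (-r) * (r : ℝ) ^ k / (k.factorial : ℝ)) • Real.exp (s * k) =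
      Real.exp (-r) * ((r * Real.exp s) ^ k / (k.factorial : ℝ)) := fun k => by
    rw [smul_eq_mul, mul_comm s, Real.exp_nat_mul, mul_pow]
    ring
  simp_rw [h]
  rw [tsum_mul_left, ← NormedSpace.exp_eq_tsum_div (𝔸 := ℝ) |> fun h => congrFun h _,
    ← Real.exp_eq_exp_ℝ, ← Real.exp_add]
  ring_nf

/-- Chernoff at `s = ±ε/2` with `e^s - 1 - s ≤ s²` gives exponent `-ε²M/2 + ε²M/4`. Allowing `M`
above the mean covers intensities below `‖x‖²`. -/
theorem poissonMeasure_abs_sub_gt_le {r : NNReal} {M ε : ℝ} (hM : (r : ℝ) ≤ M) (hε : 0 < ε)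
    (hε1 : ε ≤ 1) :
    (poissonMeasure r).real {k : ℕ | ε * M < |(k : ℝ) - r|} ≤
      2 * Real.exp (-(ε ^ 2 * M / 4)) := by
  have hr : (0 : ℝ) ≤ r := r.2
  have hquad : ∀ s : ℝ, |s| = ε / 2 → r * (Real.exp s - 1 - s) ≤ M * (ε ^ 2 / 4) := fun s hs => by
    have h1 := (le_abs_self _).trans
      (Real.abs_exp_sub_one_sub_id_le (x := s) (by rw [hs]; linarith))
    have h2 : s ^ 2 = ε ^ 2 / 4 := by rw [← sq_abs, hs]; ring
    rw [h2] at h1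
    calc _ ≤ r * (ε ^ 2 / 4) := mul_le_mul_of_nonneg_left h1 hr
      _ ≤ _ := mul_le_mul_of_nonneg_right hM (by positivity)
  have hup := measure_ge_le_exp_mul_mgf (μ := poissonMeasure r) (X := fun k : ℕ => (k : ℝ))
    (t := ε / 2) (r + ε * M) (by positivity) (integrable_exp_mul_poissonMeasure r _)
  have hlow := measure_le_le_exp_mul_mgf (μ := poissonMeasure r) (X := fun k : ℕ => (k : ℝ))
    (t := -(ε / 2)) (r - ε * M) (by linarith) (integrable_exp_mul_poissonMeasure r _)
  rw [mgf_poissonMeasure, ← Real.exp_add] at hup hlow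
  have h1 := hquad (ε / 2) (abs_of_pos (by positivity))
  have h2 := hquad (-(ε / 2)) (by rw [abs_neg, abs_of_pos (by positivity)])
  have hup' := hup.trans (Real.exp_le_exp.2 (show _ ≤ -(ε ^ 2 * M / 4) by nlinarith))
  have hlow' := hlow.trans (Real.exp_le_exp.2 (show _ ≤ -(ε ^ 2 * M / 4) by nlinarith))
  have hsub : {k : ℕ | ε * M < |(k : ℝ) - r|} ⊆
      {k : ℕ | r + ε * M ≤ (k : ℝ)} ∪ {k : ℕ | (k : ℝ) ≤ r - ε * M} := by
    intro k hk
    rcases lt_abs.1 (Set.mem_ofPred_eq ▸ hk) with h | h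
    · left; simp only [Set.mem_ofPred_eq]; linarith
    · right; simp only [Set.mem_ofPred_eq]; linarith
  calc _ ≤ _ := measureReal_mono hsub (measure_ne_top _ _)
    _ ≤ _ := measureReal_union_le _ _
    _ ≤ _ := by rw [two_mul]; exact add_le_add hup' hlow'

theorem measure_pi_not_noiseBound_le {n m : ℕ} {ε : ℝ} (hε : 0 < ε) (hε1 : ε ≤ 1) (x : Vec n)
    (b : Fin m → Vec n) :
    Measure.pi (fun i => poissonMeasure (Real.toNNReal (intensity b x i)))
        {k | ¬ NoiseBound ε b x (fun i => (k i : ℝ) - intensity b x i)} ≤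
      ENNReal.ofReal (2 * (m : ℝ) * Real.exp (-(ε ^ 2 * ‖x‖ ^ 2 / 4))) := by
  set μ : Fin m → Measure ℕ := fun i => poissonMeasure (Real.toNNReal (intensity b x i))
  set S : Fin m → Set ℕ := fun i =>
    {k | ε * max (‖x‖ ^ 2) (intensity b x i) < |(k : ℝ) - intensity b x i|}
  have hsub : {k : Fin m → ℕ | ¬ NoiseBound ε b x (fun i => (k i : ℝ) - intensity b x i)} ⊆
      ⋃ i, Function.eval i ⁻¹' S i := by
    intro k hk
    simp only [NoiseBound, Set.mem_ofPred_eq, not_forall, not_le] at hk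
    obtain ⟨i, hi⟩ := hk
    exact Set.mem_iUnion.2 ⟨i, hi⟩
  have hone : ∀ i, Measure.pi μ (Function.eval i ⁻¹' S i) ≤
      ENNReal.ofReal (2 * Real.exp (-(ε ^ 2 * ‖x‖ ^ 2 / 4))) := fun i => by
    rw [(measurePreserving_eval μ i).measure_preimage (MeasurableSet.of_discrete).nullMeasurableSet]
    have hI : (Real.toNNReal (intensity b x i) : ℝ) = intensity b x i :=
      Real.coe_toNNReal _ (sq_nonneg _)
    have h := poissonMeasure_abs_sub_gt_le (r := Real.toNNReal (intensity b x i))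
      (M := max (‖x‖ ^ 2) (intensity b x i)) (by rw [hI]; exact le_max_right _ _) hε hε1
    rw [hI] at h
    rw [← ofReal_measureReal]
    refine ENNReal.ofReal_le_ofReal (h.trans ?_)
    gcongr
    exact le_max_left _ _
  calc _ ≤ _ := measure_mono hsub
    _ ≤ _ := measure_iUnion_fintype_le _ _
    _ ≤ ∑ _i : Fin m, ENNReal.ofReal (2 * Real.exp (-(ε ^ 2 * ‖x‖ ^ 2 / 4))) :=
      Finset.sum_le_sum fun i _ => hone i
    _ = _ := by
      rw [Finset.sum_const, Finset.card_univ, Fintype.card_fin, nsmul_eq_mul,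
        ← ENNReal.ofReal_natCast, ← ENNReal.ofReal_mul (by positivity)]
      ring_nf

theorem measurable_intensity {n m : ℕ} (x : Vec n) (i : Fin m) :
    Measurable (fun b : Fin m → Vec n => intensity b x i) := by
  unfold intensity
  fun_prop

/-- Disintegrating the joint law over the design reduces this to the product-measure bound, which is
uniform in the design. -/
theorem measure_poisson_not_noiseBound_le {n m : ℕ} {Ω : Type*} [MeasurableSpace Ω]
    {P : Measure Ω} [IsProbabilityMeasure P] {a : Fin m → Ω → Vec n} {x : Vec n}
    {N : Fin m → Ω → ℕ} (ha : ∀ i, AEMeasurable (a i) P) (hN : IsPoissonData P a x N) {ε : ℝ}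
    (hε : 0 < ε) (hε1 : ε ≤ 1) :
    P {ω | ¬ NoiseBound ε (fun i => a i ω) x
        (fun i => (N i ω : ℝ) - intensity (fun j => a j ω) x i)} ≤
      ENNReal.ofReal (2 * (m : ℝ) * Real.exp (-(ε ^ 2 * ‖x‖ ^ 2 / 4))) := by
  obtain ⟨hNm, hcond⟩ := hN
  set T : Set ((Fin m → Vec n) × (Fin m → ℕ)) :=
    {p | ¬ NoiseBound ε p.1 x (fun i => (p.2 i : ℝ) - intensity p.1 x i)} with hT
  have hTm : MeasurableSet T := by
    have hT' : T = ⋃ i : Fin m, {p | ε * max (‖x‖ ^ 2) (intensity p.1 x i) <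
        |(p.2 i : ℝ) - intensity p.1 x i|} := by
      ext p
      simp [hT, NoiseBound]
    rw [hT']
    refine MeasurableSet.iUnion fun i => ?_
    have h1 : Measurable fun p : (Fin m → Vec n) × (Fin m → ℕ) => intensity p.1 x i :=
      (measurable_intensity x i).comp measurable_fst
    have h2 : Measurable fun p : (Fin m → Vec n) × (Fin m → ℕ) => (p.2 i : ℝ) :=
      (measurable_from_top (f := fun k : ℕ => (k : ℝ))).comp
        ((measurable_pi_apply i).comp measurable_snd)
    exact measurableSet_lt (by fun_prop) (by fun_prop)
  have ham : AEMeasurable (fun ω i => a i ω) P := aemeasurable_pi_lambda _ ha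
  have hNm' : AEMeasurable (fun ω i => N i ω) P := aemeasurable_pi_lambda _ hNm
  have : IsProbabilityMeasure (P.map fun ω i => a i ω) := Measure.isProbabilityMeasure_map ham
  have h1 : P {ω | ¬ NoiseBound ε (fun i => a i ω) x
        (fun i => (N i ω : ℝ) - intensity (fun j => a j ω) x i)} =
      (P.map fun ω => ((fun i => a i ω), (fun i => N i ω))) T := by
    rw [Measure.map_apply_of_aemeasurable (ham.prodMk hNm') hTm]
    rfl
  rw [h1, ← compProd_map_condDistrib hNm', Measure.compProd_apply hTm]
  calc _ ≤ ∫⁻ _b, ENNReal.ofReal (2 * (m : ℝ) * Real.exp (-(ε ^ 2 * ‖x‖ ^ 2 / 4)))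
        ∂(P.map fun ω i => a i ω) := by
        refine lintegral_mono_ae ?_
        filter_upwards [hcond] with b hb
        rw [hb]
        exact measure_pi_not_noiseBound_le hε hε1 x b
    _ = _ := by simp

/-! ### Union bound and choice of constants -/

/-- The signal `0` has no direction `e` and is treated apart: the noise bound forces all data, hence
`λ₀`, to vanish. -/
theorem signDist_le_of_zero {n m : ℕ} {α ε : ℝ} (a : Fin m → Vec n) (η : Fin m → ℝ)
    (hη : NoiseBound ε a 0 η) {z : Vec n}
    (hz : IsTruncatedSpectralEstimate α a (fun i => intensity a 0 i + η i) z) :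
    signDist z 0 ≤ 0 := by
  have hy : (fun i => intensity a 0 i + η i) = fun _ => (0 : ℝ) := by
    funext i
    have := hη i
    simp only [intensity, inner_zero_right, norm_zero] at this
    simp only [intensity, inner_zero_right]
    have h0 : |η i| ≤ 0 := by simpa using this
    rw [abs_nonpos_iff.1 h0]
    norm_num
  have hlam : lambdaZero (fun _ : Fin m => (0 : ℝ)) = 0 := by simp [lambdaZero, empMean]
  obtain ⟨v, -, hzv⟩ := hz
  rw [hy, hlam] at hzv
  have hz0 : z = 0 := by rcases hzv with h | h <;> simpa using h
  simp [hz0, signDist]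

theorem meanForm_one {n : ℕ} (e u : Vec n) : meanForm (fun _ => 1) e u = ‖u‖ ^ 2 := by
  simp [meanForm, integral_sq_gaussianReal]

/-- Half of the rate absorbs the three two-sided net bounds: `6 · 5ⁿ ≤ e^(2 + 2n)`, and `Rm/2 > 4n ≥
2 + 2n` because `n ≥ 1`. -/
theorem six_mul_five_pow_mul_exp_lt {n m : ℕ} (hn : 0 < n) {R : ℝ} (hR : 0 < R)
    (hnm : 8 / R * (n : ℝ) < m) :
    3 * ((5 : ℝ) ^ n * (2 * Real.exp (-(R * m)))) < Real.exp (-(R / 2 * m)) := by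
  have hn1 : (1 : ℝ) ≤ n := by exact_mod_cast hn
  have he2 : (6 : ℝ) ≤ Real.exp 2 := by
    have h := Real.exp_one_gt_d9
    have : Real.exp 2 = Real.exp 1 * Real.exp 1 := by rw [← Real.exp_add]; norm_num
    rw [this]
    nlinarith
  have h5 : (5 : ℝ) ^ n ≤ Real.exp (2 * n) := by
    rw [mul_comm, Real.exp_nat_mul]
    exact pow_le_pow_left₀ (by norm_num) (by linarith) n
  have hlt : 2 + 2 * (n : ℝ) < R / 2 * m := by
    rw [div_mul_eq_mul_div, div_lt_iff₀ hR] at hnm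
    linarith
  calc 3 * ((5 : ℝ) ^ n * (2 * Real.exp (-(R * m)))) = 6 * (5 : ℝ) ^ n * Real.exp (-(R * m)) := by
        ring
    _ ≤ Real.exp 2 * Real.exp (2 * n) * Real.exp (-(R * m)) := by gcongr
    _ = Real.exp (2 + 2 * n + -(R * m)) := by rw [Real.exp_add, Real.exp_add]
    _ < _ := Real.exp_lt_exp.2 (by linarith)

theorem measure_not_accurate_lt {α δ τ κ : ℝ} (hα : 3 ≤ α) (hδ : 0 < δ) (hτ : 0 < τ)
    (hτ1 : τ ≤ 1 / 15) (hτδ : 16 * τ ≤ δ) (hκδ : 32 * (2 * τ + κ) ≤ δ ^ 2)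
    (hw1 : ∫ t, noiseWeight α τ t ∂gaussianReal 0 1 ≤ κ)
    (hw2 : ∫ t, noiseWeight α τ t * t ^ 2 ∂gaussianReal 0 1 ≤ κ)
    {n m : ℕ} (hnm : 8 / deviationRate (4 * α ^ 2) (τ / 32) * (n : ℝ) < m) {x : Vec n}
    (hx : x ≠ 0) {Ω : Type*} [MeasurableSpace Ω] {P : Measure Ω} [IsProbabilityMeasure P]
    {a : Fin m → Ω → Vec n} (η : Fin m → Ω → ℝ) (ha : IsGaussianDesign P a) :
    P {ω | NoiseBound τ (fun i => a i ω) x (fun i => η i ω) ∧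
        ¬ ∀ z : Vec n,
          IsTruncatedSpectralEstimate α (fun i => a i ω)
            (fun i => intensity (fun j => a j ω) x i + η i ω) z →
          signDist z x ≤ δ * ‖x‖}
      < ENNReal.ofReal (Real.exp (-(deviationRate (4 * α ^ 2) (τ / 32) / 2 * (m : ℝ)))) := by
  have hB : 0 < 4 * α ^ 2 := by positivity
  have hR := deviationRate_pos hB (show 0 < τ / 32 by positivity)
  set R := deviationRate (4 * α ^ 2) (τ / 32) with hRdef
  have hn : 0 < n := by
    rcases Nat.eq_zero_or_pos n with rfl | h
    · exact absurd (Subsingleton.elim x 0) hx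
    · exact h
  have hm : 0 < m := by
    have : (0 : ℝ) < m := lt_of_le_of_lt (by positivity) hnm
    exact_mod_cast this
  have hr : 0 < ‖x‖ := norm_pos_iff.2 hx
  set e : Vec n := ‖x‖⁻¹ • x with he_def
  have he : ‖e‖ = 1 := by rw [norm_smul, norm_inv, norm_norm, inv_mul_cancel₀ hr.ne']
  have hxe : x = ‖x‖ • e := by rw [he_def, smul_smul, mul_inv_cancel₀ hr.ne', one_smul]
  have h32 : 32 * (τ / 32) = τ := by ring
  have hα2 : 9 ≤ α ^ 2 := by nlinarith
  -- The bound `4α²` dominates all three weights, so they share one rate; the level `τ/32` offsets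
  -- the factor `32` lost in passing from the net to the sphere.
  have p1 := measure_weightedForm_deviation_le ha (f := fun _ => 1) measurable_const hB
    (show 0 < τ / 32 by positivity) (fun _ => by rw [abs_one]; linarith) he hm
  have p2 := measure_weightedForm_deviation_le ha (measurable_truncSq α) hB
    (show 0 < τ / 32 by positivity) (fun t => (abs_truncSq_le α t).trans (by linarith)) he hm
  have p3 := measure_weightedForm_deviation_le ha (measurable_noiseWeight α τ) hB
    (show 0 < τ / 32 by positivity) (abs_noiseWeight_le hτ.le (by linarith)) he hm
  rw [h32, ← hRdef] at p1 p2 p3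
  rw [← ofReal_measureReal]
  refine (ENNReal.ofReal_lt_ofReal_iff (Real.exp_pos _)).2
    (lt_of_le_of_lt ?_ (six_mul_five_pow_mul_exp_lt hn hR hnm))
  have hsub : {ω | NoiseBound τ (fun i => a i ω) x (fun i => η i ω) ∧
        ¬ ∀ z : Vec n,
          IsTruncatedSpectralEstimate α (fun i => a i ω)
            (fun i => intensity (fun j => a j ω) x i + η i ω) z →
          signDist z x ≤ δ * ‖x‖} ⊆
      {ω | ¬ ∀ u : Vec n, |weightedForm (fun _ => 1) e (fun i => a i ω) u -
          meanForm (fun _ => 1) e u| ≤ τ * ‖u‖ ^ 2} ∪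
      ({ω | ¬ ∀ u : Vec n, |weightedForm (truncSq α) e (fun i => a i ω) u -
          meanForm (truncSq α) e u| ≤ τ * ‖u‖ ^ 2} ∪
      {ω | ¬ ∀ u : Vec n, |weightedForm (noiseWeight α τ) e (fun i => a i ω) u -
          meanForm (noiseWeight α τ) e u| ≤ τ * ‖u‖ ^ 2}) := by
    rintro ω ⟨hη, hbad⟩
    by_contra hgood
    simp only [Set.mem_union, Set.mem_ofPred_eq, not_or, not_not] at hgood
    obtain ⟨g1, g2, g3⟩ := hgood
    simp only [meanForm_one] at g1
    refine hbad fun z hz => ?_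
    rw [hxe] at hη hz
    rw [show signDist z x = signDist z (‖x‖ • e) by rw [← hxe]]
    refine signDist_le_of_good_design (κ := κ + τ) hn hm hα hδ.le hτ hτ1 hr he
      (fun i => a i ω) (fun i => η i ω) g1 g2 (fun u => ?_) hτδ (by linarith) hη hz
    have h1 := (abs_le.1 (g3 u)).2
    have h2 := meanForm_le hw1 hw2 he u
    linarith
  calc _ ≤ _ := measureReal_mono hsub (measure_ne_top _ _)
    _ ≤ _ := measureReal_union_le _ _
    _ ≤ _ := add_le_add p1 ((measureReal_union_le _ _).trans (add_le_add p2 p3))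
    _ = _ := by ring

theorem proposition3 :
    -- the truncated spectral estimate is accurate
    (∀ δ : ℝ, 0 < δ → ∀ α : ℝ, 3 ≤ α →
      ∃ ε : ℝ, 0 < ε ∧ ∃ c₀ : ℝ, 0 < c₀ ∧ ∃ c : ℝ, 0 < c ∧
        ∀ (n m : ℕ), c₀ * (n : ℝ) < (m : ℝ) → ∀ (x : Vec n)
          (Ω : Type*) [MeasurableSpace Ω] (P : Measure Ω) [IsProbabilityMeasure P]
          (a : Fin m → Ω → Vec n) (η : Fin m → Ω → ℝ),
          IsGaussianDesign P a →
          P {ω | NoiseBound ε (fun i => a i ω) x (fun i => η i ω) ∧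
              ¬ ∀ z : Vec n,
                IsTruncatedSpectralEstimate α (fun i => a i ω)
                  (fun i => intensity (fun j => a j ω) x i + η i ω) z →
                signDist z x ≤ δ * ‖x‖}
            < ENNReal.ofReal (Real.exp (-(c * (m : ℝ))))) ∧
    -- Poisson data satisfy the noise bound with high probability when `‖x‖ ≳ log m`
    (∀ C : ℝ, 0 < C → ∃ c : ℝ, 0 < c ∧
      ∀ ε : ℝ, 0 < ε → ε ≤ 1 →
        ∀ (n m : ℕ) (x : Vec n), C * Real.log (m : ℝ) ≤ ‖x‖ → ∀
          (Ω : Type*) [MeasurableSpace Ω] (P : Measure Ω) [IsProbabilityMeasure P]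
          (a : Fin m → Ω → Vec n) (N : Fin m → Ω → ℕ),
          IsGaussianDesign P a → IsPoissonData P a x N →
          P {ω | ¬ NoiseBound ε (fun i => a i ω) x
              (fun i => (N i ω : ℝ) - intensity (fun j => a j ω) x i)}
            ≤ ENNReal.ofReal
                (2 * (m : ℝ) * Real.exp (-(c * ε ^ 2 * Real.log (m : ℝ) ^ 2)))) := by
  refine ⟨fun δ hδ α hα => ?_, fun C hC => ⟨C ^ 2 / 4, by positivity, ?_⟩⟩
  · obtain ⟨τ₀, hτ₀, hsmall⟩ := exists_noiseWeight_small (α := α) (by linarith)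
      (κ := δ ^ 2 / 64) (by positivity)
    set τ := min τ₀ (min (1 / 15) (min (δ / 16) (δ ^ 2 / 128))) with hτdef
    have hτ : 0 < τ := by positivity
    have hτ1 : τ ≤ 1 / 15 := (min_le_right _ _).trans (min_le_left _ _)
    have hτ2 : τ ≤ δ / 16 :=
      (min_le_right _ _).trans ((min_le_right _ _).trans (min_le_left _ _))
    have hτ3 : τ ≤ δ ^ 2 / 128 :=
      (min_le_right _ _).trans ((min_le_right _ _).trans (min_le_right _ _))
    obtain ⟨hw1, hw2⟩ := hsmall τ hτ (min_le_left _ _)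
    have hR := deviationRate_pos (B := 4 * α ^ 2) (τ := τ / 32) (by positivity) (by positivity)
    refine ⟨τ, hτ, 8 / deviationRate (4 * α ^ 2) (τ / 32), by positivity,
      deviationRate (4 * α ^ 2) (τ / 32) / 2, by positivity, ?_⟩
    intro n m hnm x Ω _ P _ a η ha
    rcases eq_or_ne x 0 with rfl | hx
    · refine lt_of_eq_of_lt ?_ (ENNReal.ofReal_pos.2 (Real.exp_pos _))
      refine measure_mono_null ?_ (measure_empty (μ := P))
      rintro ω ⟨hη, hbad⟩
      refine hbad fun z hz => ?_
      rw [norm_zero, mul_zero]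
      exact signDist_le_of_zero _ _ hη hz
    · exact measure_not_accurate_lt hα hδ hτ hτ1 (by linarith) (by linarith) hw1 hw2 hnm hx η ha
  · intro ε hε hε1 n m x hx Ω _ P _ a N ha hN
    refine (measure_poisson_not_noiseBound_le (fun i => (ha.1 i).aemeasurable) hN hε hε1).trans
      (ENNReal.ofReal_le_ofReal ?_)
    -- Nonnegativity, needed to square the lower bound on `‖x‖`, also holds at `m = 0`, where
    -- `Real.log 0 = 0`.
    have hlog : 0 ≤ C * Real.log m := mul_nonneg hC.le (Real.log_natCast_nonneg m)
    have hsq : (C * Real.log m) ^ 2 ≤ ‖x‖ ^ 2 := pow_le_pow_left₀ hlog hx 2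
    gcongr
    nlinarith [mul_le_mul_of_nonneg_left hsq (sq_nonneg ε)]
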